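/- Let $\mathcal F$ and $\mathcal X$ be nonempty separable metric spaces whose sets of Borel probability measures $\mathcal Q$ (on $\mathcal F$) and $\mathcal P$ (on $\mathcal X$) are weakly compact. Let $\ell:\mathcal F\times\mathcal X\to[0,1]$ be an arbitrary loss function, let $\Psi$ be a nonempty set of (departure) mappings $\psi:\mathcal F\to\mathcal F$, and let $T\ge 1$ be an integer. For $f_1,\dots,f_T\in\mathcal F$ and $x_1,\dots,x_T\in\mathcal X$ define the adaptive regret $$\mathrm{Reg}_T=\sup_{1\le r\le s\le T}\Big\{\frac1T\sum_{t=r}^{s}\ell(f_t,x_t)-\inf_{\psi\in\Psi}\frac1T\sum_{t=r}^{s}\ell(\psi(f_t),x_t)\Big\},$$ and let the value of the adaptive regret game be $$\mathcal V_T=\inf_{q_1\in\mathcal Q}\ \sup_{x_1\in\mathcal X}\ \mathbb E_{f_1\sim q_1}\cdots\inf_{q_T\in\mathcal Q}\ \sup_{x_T\in\mathcal X}\ \mathbb E_{f_T\sim q_T}\,\mathrm{Reg}_T ,$$ where an expectation of a function that is not measurable is read as the outer expectation (the infimum of the expectations of its measurable integrable majorants). For a set $\mathcal Z$, a $\mathcal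 Z$-valued tree $\mathbf z$ of depth $T$ is a sequence of maps $\mathbf z_t:\{\pm1\}^{t-1}\to\mathcal Z$, $t=1,\dots,T$; write $\mathbf z_t(\epsilon)=\mathbf z_t(\epsilon_1,\dots,\epsilon_{t-1})$ for $\epsilon\in\{\pm1\}^T$. A set $V$ of real-valued trees of depth $T$ is a $\delta$-cover of $\Psi$ on an $\mathcal F\times\mathcal X$-valued tree $(\mathbf f,\mathbf x)$ of depth $T$ if for every $\psi\in\Psi$ and every $\epsilon\in\{\pm1\}^T$ there is $\mathbf v\in V$ with $\max_{t\le T}|\mathbf v_t(\epsilon)-\ell(\psi(\mathbf f_t(\epsilon)),\mathbf x_t(\epsilon))|\le\delta$. Let $\mathcal N_\infty(\delta,\Psi,T)\in\mathbb N\cup\{\infty\}$ be the supremum over all such trees $(\mathbf f,\mathbf x)$ of the minimal cardinality of a $\delta$-cover of $\Psi$ on $(\mathbf f,\mathbf x)$. Then $$\mathcal V_T\ \le\ 8\inf_{\alpha>0}\Big\{\alpha+6\sqrt2\int_\alpha^2\sqrt{\frac{\log\mathcal N_\infty(\delta,\Psi,T)}{T}}\,d\delta\Big\}+96\sqrt{\frac{\log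 T}{T}} ,$$ where the integral is $+\infty$ if the integrand is infinite on a set of positive measure (and is $0$ for $\alpha\ge 2$). -/

import Mathlib

open MeasureTheory
open scoped ENNReal

noncomputable section

namespace AdaptiveRegret

/-- Expectation of an extended-real function `g` under `μ`, as the infimum of the integrals of the
measurable integrable majorants of `g` (outer expectation). It is the usual expectation when `g`
is real-valued, measurable and integrable, and it needs no measurability of the nested
infima and suprema that occur in the value of the game. -/
def expectation {F : Type*} [MeasurableSpace F] (μ : Measure F) (g : F → EReal) : EReal :=
  ⨅ (h : F → ℝ) (_ : Measurable h) (_ : Integrable h μ) (_ : ∀ f, g f ≤ (h f : EReal)),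
    ((∫ f, h f ∂μ : ℝ) : EReal)

/-- The minimax value
`inf_{q₁} sup_{x₁} E_{f₁∼q₁} ⋯ inf_{q_n} sup_{x_n} E_{f_n∼q_n} R(f₁,…,f_n; x₁,…,x_n)`
of the `n`-round game with final payoff `R`, where each `q_t` ranges over all probability
measures on `F` and each `x_t` over `X`. -/
def gameValue {F X : Type*} [MeasurableSpace F] :
    (n : ℕ) → ((Fin n → F) → (Fin n → X) → EReal) → EReal
  | 0, R => R Fin.elim0 Fin.elim0
  | n + 1, R =>
      ⨅ q : ProbabilityMeasure F, ⨆ x : X,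
        expectation (q : Measure F) fun f =>
          gameValue n fun fs xs => R (Fin.cons f fs) (Fin.cons x xs)

/-- Adaptive regret with respect to the departure mappings `Ψ`: the supremum over intervals
`[r, s] ⊆ [T]` of
`(1/T) ∑_{t=r}^s loss(f_t, x_t) - inf_{ψ ∈ Ψ} (1/T) ∑_{t=r}^s loss(ψ(f_t), x_t)`. -/
def adaptiveRegret {F X : Type*} (loss : F → X → ℝ) (Ψ : Set (F → F)) {T : ℕ}
    (f : Fin T → F) (x : Fin T → X) : EReal :=
  ⨆ (r : Fin T) (s : Fin T) (_ : r ≤ s),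
    (((1 / (T : ℝ)) * ∑ t ∈ Finset.Icc r s, loss (f t) (x t) : ℝ) : EReal) -
      ⨅ ψ ∈ Ψ, (((1 / (T : ℝ)) * ∑ t ∈ Finset.Icc r s, loss (ψ (f t)) (x t) : ℝ) : EReal)

/-- A `Z`-valued tree of depth `T`: at each time `t` (counted from `0`) a map from the sign
sequences of length `t` to `Z`. The signs `±1` are the units of `ℤ`. -/
abbrev SignTree (Z : Type*) (T : ℕ) : Type _ :=
  (t : Fin T) → (Fin (t : ℕ) → ℤˣ) → Z

/-- The label of the tree at time `t` along the path `ε`; it only depends on the signs that come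
before time `t`. -/
def SignTree.along {Z : Type*} {T : ℕ} (z : SignTree Z T) (ε : Fin T → ℤˣ) (t : Fin T) : Z :=
  z t fun i => ε (Fin.castLE t.isLt.le i)

/-- `V` is a `δ`-cover in the `ℓ_∞` sense of the departure mappings `Ψ` on the tree `z`. -/
def IsCover {F X : Type*} (loss : F → X → ℝ) (Ψ : Set (F → F)) {T : ℕ} (δ : ℝ)
    (z : SignTree (F × X) T) (V : Set (SignTree ℝ T)) : Prop :=
  ∀ ψ ∈ Ψ, ∀ ε : Fin T → ℤˣ, ∃ v ∈ V, ∀ t : Fin T,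
    |v.along ε t - loss (ψ (z.along ε t).1) (z.along ε t).2| ≤ δ

/-- The covering number `N_∞(δ, Ψ, T)`: the supremum over all `F × X`-valued trees of depth `T` of
the smallest size of a `δ`-cover (`⊤` if there is no finite bound). -/
def coveringNumber {F X : Type*} (loss : F → X → ℝ) (Ψ : Set (F → F)) (T : ℕ) (δ : ℝ) : ℕ∞ :=
  ⨆ z : SignTree (F × X) T, ⨅ (V : Set (SignTree ℝ T)) (_ : IsCover loss Ψ δ z V), V.encard

/-- `√(log N_∞(δ, Ψ, T) / T)`, infinite if the covering number is. -/
def rootEntropy {F X : Type*} (loss : F → X → ℝ) (Ψ : Set (F → F)) (T : ℕ) (δ : ℝ) : ℝ≥0∞ :=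
  ((ENNReal.log (coveringNumber loss Ψ T δ : ℝ≥0∞)).toENNReal / (T : ℝ≥0∞)) ^ (1 / 2 : ℝ)

/-- `inf_{α > 0} {α + 6√2 ∫_α^2 √(log N_∞(δ, Ψ, T) / T) dδ}`. -/
def entropyIntegral {F X : Type*} (loss : F → X → ℝ) (Ψ : Set (F → F)) (T : ℕ) : ℝ≥0∞ :=
  ⨅ (α : ℝ) (_ : 0 < α),
    ENNReal.ofReal α +
      ENNReal.ofReal (6 * Real.sqrt 2) * ∫⁻ δ in Set.Icc α 2, rootEntropy loss Ψ T δ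

end AdaptiveRegret

end

/-!
The learner's strategy is assembled from four ingredients. No measurability or topology is needed,
since all mixed strategies that occur have finite support.

*Reduction to online learning of the comparator losses.* Put `g ψ (f, x) = loss (ψ f) x`. If a
mixture `L` over `Ψ` is played by drawing `f` from an approximately stationary law of the Markov
chain `f ↦ ψ f`, `ψ ∼ L`, then the expected loss of `f` is, up to a small error, the expected
`L`-average of `g ψ (f, x)`, for every `x` (`exists_stationary_mixture`). So it suffices to choose
mixtures over `Ψ` that compete with every `ψ` when the opponent reveals arbitrary points
`z = (f, x)`.

*A single interval.* Let `rad n φ` be the sequential Rademacher functional of `g` with offset `φ`,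
and let `φ` be minus the accumulated comparator losses. A suitable mixture keeps the potential
`rad n φ` from growing by more than `rad T 0 / T` plus an arbitrarily small amount per round
(`exists_mixture_rad_step`). This rests on a minimax theorem in which neither player has compact
strategies. When it fails with gap `a - b`, the finite minimax theorem `exists_mixture_lt` produces
an infinite half graph with that gap between mixtures of the two players; by binary search it
contains shattered trees of every depth, so that `T (a - b) ≤ rad T 0` (`le_rad_of_half_graph`,
`exists_mixture_le`). Hence the regret over any interval is at most about `2 rad T 0`.

*All intervals at once.* The recommendations for the intervals are combined by exponential weights
in which only the intervals containing the current time take part. The sum over all intervals of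
the exponentials of their potentials then grows, in expectation, by a factor `1 + η ^ 2 + o(1)` per
round (`exists_mixture_potential_round`, `gameValue_exp_potential_le`). This also takes care of the
deviations of the realized losses from their means, and costs `3 √(log T / T)`.

*Chaining.* Truncated differences of sequential covers at consecutive dyadic scales
`2 α, 4 α, 8 α, …` and a maximal inequality for finitely many trees give
`rad T 0 / (4 T) ≤ α + 6 √2 ∫_α^2 √(log N / T)` (`signAvg_iSup_le_chaining`,
`rad_le_entropyIntegral`), and `2 rad T 0 / T` is at most `8` times that.
-/

namespace AdaptiveRegret

/-! ### Finitely supported mixtures -/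

/-- The finitely supported probability measures on `S`, encoded as the expectation functionals they
induce on all real functions on `S`: the convex hull of the evaluations. -/
def mixtures (S : Type*) : Set ((S → ℝ) →ₗ[ℝ] ℝ) :=
  convexHull ℝ (Set.range fun s : S => (LinearMap.proj s : (S → ℝ) →ₗ[ℝ] ℝ))

lemma convex_mixtures (S : Type*) : Convex ℝ (mixtures S) := convex_convexHull ℝ _

lemma proj_mem_mixtures {S : Type*} (s : S) :
    (LinearMap.proj s : (S → ℝ) →ₗ[ℝ] ℝ) ∈ mixtures S :=
  subset_convexHull ℝ _ ⟨s, rfl⟩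

lemma mixtures_subset {S : Type*} {C : Set ((S → ℝ) →ₗ[ℝ] ℝ)} (hC : Convex ℝ C)
    (h : ∀ s : S, (LinearMap.proj s : (S → ℝ) →ₗ[ℝ] ℝ) ∈ C) : mixtures S ⊆ C :=
  convexHull_min (by rintro _ ⟨s, rfl⟩; exact h s) hC

lemma mixture_le {S : Type*} {L : (S → ℝ) →ₗ[ℝ] ℝ} (hL : L ∈ mixtures S) {φ : S → ℝ} {c : ℝ}
    (h : ∀ s, φ s ≤ c) : L φ ≤ c := by
  have : mixtures S ⊆ {L | L φ ≤ c} := by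
    refine mixtures_subset ?_ (fun s => h s)
    intro A hA B hB a b ha hb hab
    simp only [Set.mem_ofPred_eq, LinearMap.add_apply, LinearMap.smul_apply, smul_eq_mul] at *
    have hb' : b = 1 - a := by linarith
    subst hb'
    nlinarith
  exact this hL

lemma mixture_nonneg {S : Type*} {L : (S → ℝ) →ₗ[ℝ] ℝ} (hL : L ∈ mixtures S) {φ : S → ℝ}
    (h : ∀ s, 0 ≤ φ s) : 0 ≤ L φ := by
  have h1 := mixture_le hL (φ := -φ) (c := 0) (fun s => by simpa using h s)
  rw [map_neg] at h1
  linarith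

lemma mixture_mono {S : Type*} {L : (S → ℝ) →ₗ[ℝ] ℝ} (hL : L ∈ mixtures S) {φ φ' : S → ℝ}
    (h : ∀ s, φ s ≤ φ' s) : L φ ≤ L φ' := by
  have h1 := mixture_nonneg hL (φ := φ' - φ) (fun s => by simpa using h s)
  rw [map_sub] at h1
  linarith

lemma mixture_const {S : Type*} {L : (S → ℝ) →ₗ[ℝ] ℝ} (hL : L ∈ mixtures S) (c : ℝ) :
    L (fun _ => c) = c := by
  refine le_antisymm (mixture_le hL fun _ => le_rfl) ?_
  have h1 := mixture_le hL (φ := fun _ => -c) (c := -c) fun _ => le_rfl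
  have h2 : (fun _ : S => -c) = -(fun _ => c) := rfl
  rw [h2, map_neg] at h1
  linarith

lemma mixture_add_const {S : Type*} {L : (S → ℝ) →ₗ[ℝ] ℝ} (hL : L ∈ mixtures S) (φ : S → ℝ)
    (c : ℝ) : L (fun s => φ s + c) = L φ + c := by
  have : (fun s => φ s + c) = φ + fun _ => c := rfl
  rw [this, map_add, mixture_const hL]

lemma mixture_mem_Icc {S : Type*} {L : (S → ℝ) →ₗ[ℝ] ℝ} (hL : L ∈ mixtures S) {φ : S → ℝ}
    (h : ∀ s, φ s ∈ Set.Icc (0 : ℝ) 1) : L φ ∈ Set.Icc (0 : ℝ) 1 :=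
  ⟨mixture_nonneg hL fun s => (h s).1, mixture_le hL fun s => (h s).2⟩

/-- Averages over a mixture commute with every linear functional. -/
lemma mixture_comm {S R : Type*} {M : (S → ℝ) →ₗ[ℝ] ℝ} (hM : M ∈ mixtures S)
    (L : (R → ℝ) →ₗ[ℝ] ℝ) (g : R → S → ℝ) :
    L (fun r => M (g r)) = M (fun s => L fun r => g r s) := by
  have : mixtures S ⊆ {M | L (fun r => M (g r)) = M (fun s => L fun r => g r s)} := by
    refine mixtures_subset ?_ (fun s => rfl)
    intro A hA B hB a b ha hb hab
    simp only [Set.mem_ofPred_eq, LinearMap.add_apply, LinearMap.smul_apply, smul_eq_mul] at *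
    rw [← hA, ← hB, ← smul_eq_mul, ← smul_eq_mul, ← map_smul, ← map_smul, ← map_add]
    rfl
  exact this hM

/-- Jensen's inequality for mixtures and convex functions of vector arguments. -/
lemma mixture_jensen {S R : Type*} {M : (S → ℝ) →ₗ[ℝ] ℝ} (hM : M ∈ mixtures S)
    {C : Set (R → ℝ)} {Φ : (R → ℝ) → ℝ} (hΦ : ConvexOn ℝ C Φ) (γ : S → R → ℝ)
    (hγ : ∀ s, γ s ∈ C) :
    (fun r => M fun s => γ s r) ∈ C ∧ Φ (fun r => M fun s => γ s r) ≤ M (fun s => Φ (γ s)) := by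
  have : mixtures S ⊆ {M | (fun r => M fun s => γ s r) ∈ C ∧
      Φ (fun r => M fun s => γ s r) ≤ M (fun s => Φ (γ s))} := by
    refine mixtures_subset ?_ (fun s => ⟨hγ s, le_rfl⟩)
    rintro A ⟨hA, hA'⟩ B ⟨hB, hB'⟩ a b ha hb hab
    have e : (fun r => (a • A + b • B) fun s => γ s r) =
        a • (fun r => A fun s => γ s r) + b • (fun r => B fun s => γ s r) := rfl
    refine ⟨?_, ?_⟩
    · rw [e]; exact hΦ.1 hA hB ha hb hab
    · rw [e]
      refine (hΦ.2 hA hB ha hb hab).trans ?_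
      simp only [LinearMap.add_apply, LinearMap.smul_apply, smul_eq_mul]
      gcongr
  exact this hM

/-- A mixture over `r` of mixtures on `S`, the components of the linear map `N`, is a mixture on
`S`. -/
lemma mixture_bind {S R : Type*} {L : (R → ℝ) →ₗ[ℝ] ℝ} (hL : L ∈ mixtures R)
    {N : (S → ℝ) →ₗ[ℝ] (R → ℝ)} (hN : ∀ r, (LinearMap.proj r).comp N ∈ mixtures S) :
    L.comp N ∈ mixtures S := by
  have : mixtures R ⊆ {L | L.comp N ∈ mixtures S} := by
    refine mixtures_subset ?_ (fun r => hN r)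
    intro A hA B hB a b ha hb hab
    simp only [Set.mem_ofPred_eq, LinearMap.add_comp, LinearMap.smul_comp] at *
    exact convex_mixtures S hA hB ha hb hab
  exact this hL

lemma mixtures_nonempty (S : Type*) [Nonempty S] : (mixtures S).Nonempty :=
  ⟨_, proj_mem_mixtures (Classical.arbitrary S)⟩

/-- The minimax theorem for a player with finitely many options `ι`: if every mixture over `ι` is
met by some `s` with payoff above `c`, then one mixture over `S` has payoff above `c` against all
of `ι`. The set of achievable payoff vectors would otherwise be separated from an orthant, and the
separating functional is a mixture over `ι`. -/
lemma exists_mixture_lt {S ι : Type*} [Nonempty S] [Fintype ι] (h : S → ι → ℝ) (c : ℝ)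
    (H : ∀ u ∈ stdSimplex ℝ ι, ∃ s, c < ∑ i, u i * h s i) :
    ∃ L ∈ mixtures S, ∀ i, c < L (fun s => h s i) := by
  classical
  by_cases hι : Nonempty ι
  swap
  · obtain ⟨L, hL⟩ := mixtures_nonempty S
    exact ⟨L, hL, fun i => (hι ⟨i⟩).elim⟩
  by_contra! hcon
  let V : ((S → ℝ) →ₗ[ℝ] ℝ) →ₗ[ℝ] (ι → ℝ) :=
    { toFun := fun L i => L fun s => h s i
      map_add' := fun _ _ => rfl
      map_smul' := fun _ _ => rfl }
  have hopen : IsOpen {y : ι → ℝ | ∀ i, c < y i} := by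
    simp only [Set.ofPred_forall]
    exact isOpen_iInter_of_finite fun i => isOpen_lt continuous_const (continuous_apply i)
  have hconv : Convex ℝ {y : ι → ℝ | ∀ i, c < y i} := by
    simp only [Set.ofPred_forall]
    exact convex_iInter fun i => (convex_Ioi c).linear_preimage
      (LinearMap.proj i : (ι → ℝ) →ₗ[ℝ] ℝ)
  have hdisj : Disjoint {y : ι → ℝ | ∀ i, c < y i} (V '' mixtures S) := by
    rw [Set.disjoint_left]
    rintro y hy ⟨L, hL, rfl⟩
    obtain ⟨i, hi⟩ := hcon L hL
    exact absurd (hy i) (not_lt.2 hi)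
  obtain ⟨f, u, hf1, hf2⟩ := geometric_hahn_banach_open hconv hopen
    ((convex_mixtures S).linear_image V) hdisj
  let e : ι → ℝ := fun i => f (Pi.single i 1)
  have hf : ∀ y : ι → ℝ, f y = ∑ i, y i * e i := by
    intro y
    conv_lhs => rw [pi_eq_sum_univ' y]
    simp [e, map_sum]
  have hadd : ∀ i, ∀ N : ℝ, 0 ≤ N → f (fun _ => c + 1) + N * e i < u := by
    intro i N hN
    have : f ((fun _ => c + 1) + N • Pi.single i (1 : ℝ)) < u := by
      apply hf1
      intro j
      by_cases hj : j = i
      · subst hj; simp; linarith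
      · simp [hj]
    simpa [e] using this
  have he : ∀ i, e i ≤ 0 := by
    intro i
    by_contra! hi
    have h1 := hadd i (|u - f (fun _ => c + 1)| / e i) (by positivity)
    rw [div_mul_cancel₀ _ hi.ne'] at h1
    linarith [le_abs_self (u - f (fun _ => c + 1))]
  have hcu : c * ∑ i, e i ≤ u := by
    have hlim : Filter.Tendsto (fun t : ℝ => (c + t) * ∑ i, e i) (nhdsWithin 0 (Set.Ioi 0))
        (nhds ((c + 0) * ∑ i, e i)) :=
      (Continuous.tendsto (by fun_prop) 0).mono_left nhdsWithin_le_nhds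
    rw [add_zero] at hlim
    refine le_of_tendsto hlim ?_
    filter_upwards [self_mem_nhdsWithin] with t ht
    have := hf1 (fun _ => c + t) (fun i => by simpa using ht)
    rw [hf, ← Finset.mul_sum] at this
    exact this.le
  have hS : ∀ s, c * ∑ i, e i ≤ ∑ i, h s i * e i := by
    intro s
    have h2 := hf2 _ ⟨_, proj_mem_mixtures s, rfl⟩
    rw [hf] at h2
    exact hcu.trans h2
  have hneg : ∑ i, e i < 0 := by
    refine lt_of_le_of_ne (Finset.sum_nonpos fun i _ => he i) fun h0 => ?_
    have hz : ∀ i, e i = 0 := fun i =>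
      (Finset.sum_eq_zero_iff_of_nonpos fun i _ => he i).1 h0 i (Finset.mem_univ i)
    have h1 := hf1 (fun _ => c + 1) (fun i => by simp)
    have h2 := hf2 _ ⟨_, proj_mem_mixtures (Classical.arbitrary S), rfl⟩
    simp only [hf, hz, mul_zero, Finset.sum_const_zero] at h1 h2
    linarith
  obtain ⟨s, hs⟩ := H (fun i => e i / ∑ j, e j)
    ⟨fun i => div_nonneg_of_nonpos (he i) hneg.le, by
      rw [← Finset.sum_div, div_self hneg.ne]⟩
  have h3 := hS s
  have h4 : ∑ i, e i / (∑ j, e j) * h s i = (∑ i, h s i * e i) / ∑ j, e j := by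
    rw [Finset.sum_div]
    exact Finset.sum_congr rfl fun i _ => by ring
  rw [h4, lt_div_iff_of_neg hneg] at hs
  linarith

/-! ### The sequential Rademacher functional -/

/-- The sequential Rademacher functional of depth `n` with offset `φ`, in dynamic programming form:
`sup_z E_ε sup_i (φ i + 2 ∑ₜ εₜ g i (zₜ(ε)))`, where `z` ranges over the trees of depth `n`. The
factor `2` is the one that symmetrization produces. -/
noncomputable def rad {I Z : Type*} (g : I → Z → ℝ) : ℕ → (I → ℝ) → ℝ
  | 0, φ => ⨆ i, φ i
  | n + 1, φ => ⨆ z, (rad g n (fun i => φ i + 2 * g i z) + rad g n (fun i => φ i - 2 * g i z)) / 2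

section Rad

variable {I Z : Type*} {g : I → Z → ℝ}

lemma bddAbove_add {φ γ : I → ℝ} {c : ℝ} (hφ : BddAbove (Set.range φ)) (hγ : ∀ i, γ i ≤ c) :
    BddAbove (Set.range fun i => φ i + γ i) := by
  obtain ⟨C, hC⟩ := hφ
  refine ⟨C + c, ?_⟩
  rintro _ ⟨i, rfl⟩
  exact add_le_add (hC ⟨i, rfl⟩) (hγ i)

lemma bddAbove_add_two (hg : ∀ i z, g i z ∈ Set.Icc (0 : ℝ) 1) {φ : I → ℝ}
    (hφ : BddAbove (Set.range φ)) (z : Z) : BddAbove (Set.range fun i => φ i + 2 * g i z) :=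
  bddAbove_add (γ := fun i => 2 * g i z) (c := 2) hφ fun i => by linarith [(hg i z).2]

lemma bddAbove_sub_two (hg : ∀ i z, g i z ∈ Set.Icc (0 : ℝ) 1) {φ : I → ℝ}
    (hφ : BddAbove (Set.range φ)) (z : Z) : BddAbove (Set.range fun i => φ i - 2 * g i z) := by
  simp only [sub_eq_add_neg]
  exact bddAbove_add (γ := fun i => -(2 * g i z)) (c := 0) hφ fun i => by linarith [(hg i z).1]

lemma bddAbove_sub_one (hg : ∀ i z, g i z ∈ Set.Icc (0 : ℝ) 1) {φ : I → ℝ}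
    (hφ : BddAbove (Set.range φ)) (z : Z) : BddAbove (Set.range fun i => φ i - g i z) := by
  simp only [sub_eq_add_neg]
  exact bddAbove_add (γ := fun i => -g i z) (c := 0) hφ fun i => by linarith [(hg i z).1]

lemma bddAbove_range_const (c : ℝ) : BddAbove (Set.range fun _ : I => c) :=
  ⟨c, by rintro _ ⟨i, rfl⟩; rfl⟩

lemma le_rad_zero {φ : I → ℝ} (hφ : BddAbove (Set.range φ)) (i : I) : φ i ≤ rad g 0 φ :=
  le_ciSup hφ i

variable [Nonempty I] [Nonempty Z]

lemma rad_le (hg : ∀ i z, g i z ∈ Set.Icc (0 : ℝ) 1) (n : ℕ) {φ : I → ℝ} {C : ℝ}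
    (hφ : ∀ i, φ i ≤ C) : rad g n φ ≤ C + 2 * n := by
  induction n generalizing φ C with
  | zero => simpa [rad] using ciSup_le hφ
  | succ n ih =>
    refine ciSup_le fun z => ?_
    have h1 := ih (φ := fun i => φ i + 2 * g i z) (C := C + 2)
      fun i => by linarith [hφ i, (hg i z).2]
    have h2 := ih (φ := fun i => φ i - 2 * g i z) (C := C)
      fun i => by linarith [hφ i, (hg i z).1]
    push_cast
    linarith

lemma step_le_rad (hg : ∀ i z, g i z ∈ Set.Icc (0 : ℝ) 1) (n : ℕ) {φ : I → ℝ}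
    (hφ : BddAbove (Set.range φ)) (z : Z) :
    (rad g n (fun i => φ i + 2 * g i z) + rad g n (fun i => φ i - 2 * g i z)) / 2 ≤
      rad g (n + 1) φ := by
  refine le_ciSup (f := fun z => (rad g n (fun i => φ i + 2 * g i z) +
    rad g n (fun i => φ i - 2 * g i z)) / 2) ?_ z
  obtain ⟨C, hC⟩ := hφ
  refine ⟨C + 2 + 2 * n, ?_⟩
  rintro _ ⟨z, rfl⟩
  have h1 := rad_le hg n (φ := fun i => φ i + 2 * g i z) (C := C + 2)
    fun i => by linarith [hC ⟨i, rfl⟩, (hg i z).2]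
  have h2 := rad_le hg n (φ := fun i => φ i - 2 * g i z) (C := C + 2)
    fun i => by linarith [hC ⟨i, rfl⟩, (hg i z).1]
  dsimp only
  linarith

lemma convexOn_rad (hg : ∀ i z, g i z ∈ Set.Icc (0 : ℝ) 1) (n : ℕ) :
    ConvexOn ℝ {φ : I → ℝ | BddAbove (Set.range φ)} (rad g n) := by
  have hconv : Convex ℝ {φ : I → ℝ | BddAbove (Set.range φ)} := by
    rintro φ ⟨C, hC⟩ φ' ⟨C', hC'⟩ a b ha hb hab
    refine ⟨a * C + b * C', ?_⟩
    rintro _ ⟨i, rfl⟩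
    exact add_le_add (mul_le_mul_of_nonneg_left (hC ⟨i, rfl⟩) ha)
      (mul_le_mul_of_nonneg_left (hC' ⟨i, rfl⟩) hb)
  refine ⟨hconv, ?_⟩
  induction n with
  | zero =>
    intro φ hφ φ' hφ' a b ha hb hab
    refine ciSup_le fun i => ?_
    exact add_le_add (mul_le_mul_of_nonneg_left (le_ciSup hφ i) ha)
      (mul_le_mul_of_nonneg_left (le_ciSup hφ' i) hb)
  | succ n ih =>
    intro φ hφ φ' hφ' a b ha hb hab
    refine ciSup_le fun z => ?_
    have h1 := ih (bddAbove_add_two hg hφ z) (bddAbove_add_two hg hφ' z) ha hb hab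
    have h2 := ih (bddAbove_sub_two hg hφ z) (bddAbove_sub_two hg hφ' z) ha hb hab
    have e1 : (a • fun i => φ i + 2 * g i z) + (b • fun i => φ' i + 2 * g i z) =
        fun i => (a • φ + b • φ') i + 2 * g i z := by
      ext i
      simp only [Pi.add_apply, Pi.smul_apply, smul_eq_mul]
      linear_combination (2 * g i z) * hab
    have e2 : (a • fun i => φ i - 2 * g i z) + (b • fun i => φ' i - 2 * g i z) =
        fun i => (a • φ + b • φ') i - 2 * g i z := by
      ext i
      simp only [Pi.add_apply, Pi.smul_apply, smul_eq_mul]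
      linear_combination (-2 * g i z) * hab
    rw [e1] at h1
    rw [e2] at h2
    have h3 := mul_le_mul_of_nonneg_left (step_le_rad hg n hφ z) ha
    have h4 := mul_le_mul_of_nonneg_left (step_le_rad hg n hφ' z) hb
    simp only [smul_eq_mul] at h1 h2 ⊢
    linarith

lemma rad_mono (hg : ∀ i z, g i z ∈ Set.Icc (0 : ℝ) 1) (n : ℕ) {φ φ' : I → ℝ}
    (hφ' : BddAbove (Set.range φ')) (h : ∀ i, φ i ≤ φ' i) : rad g n φ ≤ rad g n φ' := by
  induction n generalizing φ φ' with
  | zero => exact ciSup_mono hφ' h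
  | succ n ih =>
    refine ciSup_le fun z => le_trans ?_ (step_le_rad hg n hφ' z)
    have h1 := ih (bddAbove_add_two hg hφ' z) (φ := fun i => φ i + 2 * g i z)
      fun i => by linarith [h i]
    have h2 := ih (bddAbove_sub_two hg hφ' z) (φ := fun i => φ i - 2 * g i z)
      fun i => by linarith [h i]
    linarith

lemma rad_add_const (hg : ∀ i z, g i z ∈ Set.Icc (0 : ℝ) 1) (n : ℕ) {φ : I → ℝ}
    (hφ : BddAbove (Set.range φ)) (c : ℝ) : rad g n φ + c ≤ rad g n (fun i => φ i + c) := by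
  have hφc : BddAbove (Set.range fun i => φ i + c) :=
    bddAbove_add (γ := fun _ => c) hφ fun _ => le_rfl
  induction n generalizing φ with
  | zero =>
    rw [← le_sub_iff_add_le]
    exact ciSup_le fun i => le_sub_iff_add_le.2 (le_ciSup hφc i)
  | succ n ih =>
    rw [← le_sub_iff_add_le]
    refine ciSup_le fun z => le_sub_iff_add_le.2 (le_trans ?_ (step_le_rad hg n hφc z))
    have h1 := ih (bddAbove_add_two hg hφ z)
      (bddAbove_add (γ := fun _ => c) (bddAbove_add_two hg hφ z) fun _ => le_rfl)
    have h2 := ih (bddAbove_sub_two hg hφ z)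
      (bddAbove_add (γ := fun _ => c) (bddAbove_sub_two hg hφ z) fun _ => le_rfl)
    have e1 : (fun i => φ i + 2 * g i z + c) = fun i => φ i + c + 2 * g i z := by ext; ring
    have e2 : (fun i => φ i - 2 * g i z + c) = fun i => φ i + c - 2 * g i z := by ext; ring
    rw [e1] at h1
    rw [e2] at h2
    linarith

/-- A midpoint form of the convexity of `rad`. -/
lemma rad_midpoint (hg : ∀ i z, g i z ∈ Set.Icc (0 : ℝ) 1) (n : ℕ) {φ φ₁ φ₂ : I → ℝ}
    (h₁ : BddAbove (Set.range φ₁)) (h₂ : BddAbove (Set.range φ₂))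
    (h : ∀ i, φ i = (φ₁ i + φ₂ i) / 2) : rad g n φ ≤ (rad g n φ₁ + rad g n φ₂) / 2 := by
  have h3 := (convexOn_rad hg n).2 h₁ h₂ (show (0 : ℝ) ≤ 1 / 2 by norm_num)
    (show (0 : ℝ) ≤ 1 / 2 by norm_num) (by norm_num)
  have e : ((1 / 2 : ℝ) • φ₁ + (1 / 2 : ℝ) • φ₂) = φ := by
    ext i
    simp only [Pi.add_apply, Pi.smul_apply, smul_eq_mul, h i]
    ring
  rw [e] at h3
  simp only [smul_eq_mul] at h3
  linarith

lemma rad_le_succ (hg : ∀ i z, g i z ∈ Set.Icc (0 : ℝ) 1) (n : ℕ) {φ : I → ℝ}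
    (hφ : BddAbove (Set.range φ)) : rad g n φ ≤ rad g (n + 1) φ :=
  (rad_midpoint hg n (bddAbove_add_two hg hφ (Classical.arbitrary Z))
    (bddAbove_sub_two hg hφ _) fun i => by ring).trans (step_le_rad hg n hφ _)

lemma rad_zero_mono (hg : ∀ i z, g i z ∈ Set.Icc (0 : ℝ) 1) {m n : ℕ} (h : m ≤ n) :
    rad g m (fun _ => 0) ≤ rad g n (fun _ => 0) :=
  monotone_nat_of_le_succ (f := fun n => rad g n fun _ => 0)
    (fun k => rad_le_succ hg k (bddAbove_range_const 0)) h

lemma rad_zero_nonneg (hg : ∀ i z, g i z ∈ Set.Icc (0 : ℝ) 1) (n : ℕ) :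
    0 ≤ rad g n (fun _ => 0) := by
  refine le_trans ?_ (rad_zero_mono hg n.zero_le)
  exact le_rad_zero (g := g) (φ := fun _ : I => (0 : ℝ)) (bddAbove_range_const 0)
    (Classical.arbitrary I)

lemma step_mixture_le_rad (hg : ∀ i z, g i z ∈ Set.Icc (0 : ℝ) 1) (n : ℕ) {φ : I → ℝ}
    (hφ : BddAbove (Set.range φ)) {M : (Z → ℝ) →ₗ[ℝ] ℝ} (hM : M ∈ mixtures Z) :
    (rad g n (fun i => φ i + 2 * M (g i)) + rad g n (fun i => φ i - 2 * M (g i))) / 2 ≤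
      rad g (n + 1) φ := by
  have h1 := (mixture_jensen hM (convexOn_rad hg n) (fun z i => φ i + 2 * g i z)
    fun z => bddAbove_add_two hg hφ z).2
  have h2 := (mixture_jensen hM (convexOn_rad hg n) (fun z i => φ i - 2 * g i z)
    fun z => bddAbove_sub_two hg hφ z).2
  have e1 : (fun i => M fun z => φ i + 2 * g i z) = fun i => φ i + 2 * M (g i) := by
    ext i
    have : (fun z => φ i + 2 * g i z) = (fun _ => φ i) + (2 : ℝ) • g i := rfl
    rw [this, map_add, map_smul, mixture_const hM, smul_eq_mul]
  have e2 : (fun i => M fun z => φ i - 2 * g i z) = fun i => φ i - 2 * M (g i) := by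
    ext i
    have : (fun z => φ i - 2 * g i z) = (fun _ => φ i) - (2 : ℝ) • g i := rfl
    rw [this, map_sub, map_smul, mixture_const hM, smul_eq_mul]
  rw [e1] at h1
  rw [e2] at h2
  have h3 := mixture_le hM (fun z => step_le_rad hg n hφ z)
  have e3 : (fun z => (rad g n (fun i => φ i + 2 * g i z) +
      rad g n (fun i => φ i - 2 * g i z)) / 2) =
      (1 / 2 : ℝ) • ((fun z => rad g n (fun i => φ i + 2 * g i z)) +
        fun z => rad g n (fun i => φ i - 2 * g i z)) := by
    ext z
    simp only [Pi.add_apply, Pi.smul_apply, smul_eq_mul]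
    ring
  rw [e3, map_smul, map_add, smul_eq_mul] at h3
  linarith

/-- A half graph of length `2 ^ d` between mixtures over `I` and mixtures over `Z`, with gap
`a - b`, is shattered by a tree of depth `d` (binary search), which bounds `rad` from below. -/
lemma le_rad_of_half_graph (hg : ∀ i z, g i z ∈ Set.Icc (0 : ℝ) 1)
    {L : ℕ → (I → ℝ) →ₗ[ℝ] ℝ} (hL : ∀ n, L n ∈ mixtures I)
    {M : ℕ → (Z → ℝ) →ₗ[ℝ] ℝ} (hM : ∀ n, M n ∈ mixtures Z) (v : ℕ → ℝ) {a b : ℝ}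
    (hhigh : ∀ m n, m ≤ n → a ≤ L m (fun i => M n (g i)) + v n)
    (hlow : ∀ m n, n < m → L m (fun i => M n (g i)) + v n ≤ b)
    (d o : ℕ) {φ : I → ℝ} (hφ : BddAbove (Set.range φ)) {c : ℝ}
    (hc : ∀ n, o ≤ n → n < o + 2 ^ d → c ≤ L n φ) : c + d * (a - b) ≤ rad g d φ := by
  induction d generalizing o φ c with
  | zero =>
    have h1 := hc o le_rfl (by simp)
    have h2 := mixture_le (hL o) (fun i => le_rad_zero (g := g) hφ i)
    simpa using h1.trans h2
  | succ d ih =>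
    have hpos : 0 < 2 ^ d := by positivity
    have hpow : 2 ^ (d + 1) = 2 ^ d + 2 ^ d := by ring
    set j := o + 2 ^ d - 1 with hj
    have hMg : ∀ i, M j (g i) ∈ Set.Icc (0 : ℝ) 1 := fun i => mixture_mem_Icc (hM j) (hg i)
    have hb1 : BddAbove (Set.range fun i => φ i + 2 * M j (g i)) :=
      bddAbove_add (γ := fun i => 2 * M j (g i)) (c := 2) hφ fun i => by linarith [(hMg i).2]
    have hb2 : BddAbove (Set.range fun i => φ i - 2 * M j (g i)) := by
      simp only [sub_eq_add_neg]
      exact bddAbove_add (γ := fun i => -(2 * M j (g i))) (c := 0) hφ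
        fun i => by linarith [(hMg i).1]
    have h1 := ih o hb1 (c := c + 2 * (a - v j)) (by
      intro n hn hn'
      have e : (fun i => φ i + 2 * M j (g i)) = φ + (2 : ℝ) • fun i => M j (g i) := rfl
      rw [e, map_add, map_smul, smul_eq_mul]
      have := hhigh n j (by omega)
      have := hc n hn (by omega)
      linarith)
    have h2 := ih (o + 2 ^ d) hb2 (c := c - 2 * (b - v j)) (by
      intro n hn hn'
      have e : (fun i => φ i - 2 * M j (g i)) = φ - (2 : ℝ) • fun i => M j (g i) := rfl
      rw [e, map_sub, map_smul, smul_eq_mul]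
      have := hlow n j (by omega)
      have := hc n (by omega) (by omega)
      linarith)
    have h3 := step_mixture_le_rad hg d hφ (hM j)
    push_cast
    linarith

/-- An approximate minimax theorem for the one-round game with payoff `g i z + v z`: if against
every mixture over `Z` some `i` has payoff below `b`, then a mixture over `I` has payoff at most
`a` against all `z`, as soon as `a - b` exceeds the sequential Rademacher average. No compactness
is available; instead, the failure of the conclusion yields a half graph between mixtures of both
players, which `le_rad_of_half_graph` excludes. -/
lemma exists_mixture_le (hg : ∀ i z, g i z ∈ Set.Icc (0 : ℝ) 1) (d : ℕ) (v : Z → ℝ) {a b : ℝ}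
    (hab : rad g d (fun _ => 0) < d * (a - b))
    (hb : ∀ M ∈ mixtures Z, ∃ i, M (g i) + M v < b) :
    ∃ L ∈ mixtures I, ∀ z, L (fun i => g i z) + v z ≤ a := by
  by_contra! hcon
  have hlow : ∀ s : Finset ((Z → ℝ) →ₗ[ℝ] ℝ), (∀ M ∈ s, M ∈ mixtures Z) →
      ∃ L ∈ mixtures I, ∀ M ∈ s, L (fun i => M (g i)) + M v < b := by
    intro s hs
    obtain ⟨L, hL, h⟩ := exists_mixture_lt (S := I) (ι := s)
      (fun i M => -((M : (Z → ℝ) →ₗ[ℝ] ℝ) (g i) + (M : (Z → ℝ) →ₗ[ℝ] ℝ) v)) (-b) (by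
        rintro u ⟨hu0, hu1⟩
        have hmem : (∑ M : s, u M • (M : (Z → ℝ) →ₗ[ℝ] ℝ)) ∈ mixtures Z :=
          (convex_mixtures Z).sum_mem (fun M _ => hu0 M) hu1 (fun M _ => hs M M.2)
        obtain ⟨i, hi⟩ := hb _ hmem
        refine ⟨i, ?_⟩
        simp only [LinearMap.sum_apply, LinearMap.smul_apply, smul_eq_mul] at hi
        rw [← Finset.sum_add_distrib] at hi
        simp only [mul_neg, Finset.sum_neg_distrib, mul_add]
        linarith)
    refine ⟨L, hL, fun M hM => ?_⟩
    have h1 := h ⟨M, hM⟩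
    have e : (fun i => -(M (g i) + M v)) = -(fun i => M (g i) + M v) := rfl
    dsimp only at h1
    rw [e, map_neg, mixture_add_const hL] at h1
    linarith
  have hhigh : ∀ s : Finset ((I → ℝ) →ₗ[ℝ] ℝ), (∀ L ∈ s, L ∈ mixtures I) →
      ∃ M ∈ mixtures Z, ∀ L ∈ s, a < L (fun i => M (g i)) + M v := by
    intro s hs
    obtain ⟨M, hM, h⟩ := exists_mixture_lt (S := Z) (ι := s)
      (fun z L => (L : (I → ℝ) →ₗ[ℝ] ℝ) (fun i => g i z) + v z) a (by
        rintro u ⟨hu0, hu1⟩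
        have hmem : (∑ L : s, u L • (L : (I → ℝ) →ₗ[ℝ] ℝ)) ∈ mixtures I :=
          (convex_mixtures I).sum_mem (fun L _ => hu0 L) hu1 (fun L _ => hs L L.2)
        obtain ⟨z, hz⟩ := hcon _ hmem
        refine ⟨z, ?_⟩
        simp only [LinearMap.sum_apply, LinearMap.smul_apply, smul_eq_mul] at hz
        simpa only [mul_add, Finset.sum_add_distrib, ← Finset.sum_mul, hu1, one_mul] using hz)
    refine ⟨M, hM, fun L hL => ?_⟩
    have h1 := h ⟨L, hL⟩
    have e : (fun z => L (fun i => g i z) + v z) = (fun z => L (fun i => g i z)) + v := rfl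
    dsimp only at h1
    rwa [e, map_add, ← mixture_comm hM L g] at h1
  classical
  obtain ⟨f, hf1, hf2⟩ := exists_seq_of_forall_finset_exists
    (fun p : ((I → ℝ) →ₗ[ℝ] ℝ) × ((Z → ℝ) →ₗ[ℝ] ℝ) =>
      (p.1 ∈ mixtures I ∧ p.2 ∈ mixtures Z) ∧ a < p.1 (fun i => p.2 (g i)) + p.2 v)
    (fun p q => a < p.1 (fun i => q.2 (g i)) + q.2 v ∧ q.1 (fun i => p.2 (g i)) + p.2 v < b) (by
      intro s hs
      obtain ⟨L, hL, hL'⟩ := hlow (s.image Prod.snd) (by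
        intro M hM
        obtain ⟨p, hp, rfl⟩ := Finset.mem_image.1 hM
        exact (hs p hp).1.2)
      obtain ⟨M, hM, hM'⟩ := hhigh (insert L (s.image Prod.fst)) (by
        intro L' hL'
        rcases Finset.mem_insert.1 hL' with rfl | hL'
        · exact hL
        · obtain ⟨p, hp, rfl⟩ := Finset.mem_image.1 hL'
          exact (hs p hp).1.1)
      exact ⟨(L, M), ⟨⟨hL, hM⟩, hM' L (Finset.mem_insert_self _ _)⟩, fun p hp =>
        ⟨hM' _ (Finset.mem_insert_of_mem (Finset.mem_image_of_mem _ hp)),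
          hL' _ (Finset.mem_image_of_mem _ hp)⟩⟩)
  have h1 := le_rad_of_half_graph hg (L := fun n => (f n).1) (M := fun n => (f n).2)
    (fun n => (hf1 n).1.1) (fun n => (hf1 n).1.2) (fun n => (f n).2 v) (a := a) (b := b)
    (fun m n hmn => by
      rcases hmn.eq_or_lt with rfl | hmn
      · exact (hf1 m).2.le
      · exact (hf2 m n hmn).1.le)
    (fun m n hnm => (hf2 n m hnm).2.le) d 0 (φ := fun _ => 0) (bddAbove_range_const 0) (c := 0)
    (fun n _ _ => (mixture_const (hf1 n).1.1 0).ge)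
  linarith

/-- One round of online learning: the potential `rad` together with a small additive slack can be
maintained against every `z`. By the approximate minimax theorem it suffices to answer a known
mixture over `Z`; the best response is compared with an independent copy of `z`, and the
convexity of `rad` replaces the introduction of random signs. -/
lemma exists_mixture_rad_step (hg : ∀ i z, g i z ∈ Set.Icc (0 : ℝ) 1) {T : ℕ} (hT : 1 ≤ T)
    (n : ℕ) {φ : I → ℝ} (hφ : BddAbove (Set.range φ)) {κ : ℝ} (hκ : 0 < κ) :
    ∃ L ∈ mixtures I, ∀ z, L (fun i => g i z) + rad g n (fun i => φ i - g i z) ≤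
      rad g (n + 1) φ + (rad g T (fun _ => 0) / T + κ) := by
  have hT' : (0 : ℝ) < T := by exact_mod_cast hT
  refine exists_mixture_le hg T (fun z => rad g n (fun i => φ i - g i z))
    (b := rad g (n + 1) φ + κ / 2) ?_ ?_
  · have : (T : ℝ) * (rad g (n + 1) φ + (rad g T (fun _ => 0) / T + κ) -
        (rad g (n + 1) φ + κ / 2)) = rad g T (fun _ => 0) + T * κ / 2 := by
      field_simp
      ring
    rw [this]
    have := mul_pos hT' hκ
    linarith
  · intro M hM
    have hbdd : BddBelow (Set.range fun i => M (g i)) :=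
      ⟨0, by rintro _ ⟨i, rfl⟩; exact mixture_nonneg hM fun z => (hg i z).1⟩
    obtain ⟨i, hi⟩ := exists_lt_of_ciInf_lt
      (show (⨅ i, M (g i)) < (⨅ i, M (g i)) + κ / 2 by linarith)
    refine ⟨i, ?_⟩
    set c := ⨅ i, M (g i) with hc
    suffices c + M (fun z => rad g n (fun i => φ i - g i z)) ≤ rad g (n + 1) φ by linarith
    have hA : ∀ z, rad g n (fun i => φ i - g i z) + c ≤
        (rad g n (fun i => φ i - 2 * g i z) + M fun z' => rad g n (fun i => φ i + 2 * g i z'))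
          / 2 := by
      intro z
      have hb1 : ∀ z', BddAbove (Set.range fun i => φ i - g i z + g i z') := fun z' =>
        bddAbove_add (γ := fun i => g i z') (c := 1) (bddAbove_sub_one hg hφ z)
          fun i => (hg i z').2
      have hb2 : BddAbove (Set.range fun i => φ i - g i z + M (g i)) :=
        bddAbove_add (γ := fun i => M (g i)) (c := 1) (bddAbove_sub_one hg hφ z)
          fun i => mixture_le hM fun z' => (hg i z').2
      have h1 := rad_add_const hg n (bddAbove_sub_one hg hφ z) c
      have h2 := rad_mono hg n (φ := fun i => φ i - g i z + c) hb2
        fun i => by linarith [ciInf_le hbdd i]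
      have h3 := (mixture_jensen hM (convexOn_rad hg n) (fun z' i => φ i - g i z + g i z') hb1).2
      have e : (fun i => M fun z' => φ i - g i z + g i z') = fun i => φ i - g i z + M (g i) := by
        ext i
        have : (fun z' => φ i - g i z + g i z') = (fun _ => φ i - g i z) + g i := rfl
        rw [this, map_add, mixture_const hM]
      rw [e] at h3
      have h4 : M (fun z' => rad g n (fun i => φ i - g i z + g i z')) ≤
          M ((1 / 2 : ℝ) • ((fun _ => rad g n (fun i => φ i - 2 * g i z)) +
            fun z' => rad g n (fun i => φ i + 2 * g i z'))) := by
        refine mixture_mono hM fun z' => ?_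
        have := rad_midpoint hg n (φ := fun i => φ i - g i z + g i z')
          (bddAbove_sub_two hg hφ z) (bddAbove_add_two hg hφ z') fun i => by ring
        simp only [Pi.add_apply, Pi.smul_apply, smul_eq_mul]
        linarith
      rw [map_smul, map_add, mixture_const hM, smul_eq_mul] at h4
      linarith
    have h5 := mixture_mono hM hA
    rw [mixture_add_const hM] at h5
    have e : (fun z => (rad g n (fun i => φ i - 2 * g i z) +
        M fun z' => rad g n (fun i => φ i + 2 * g i z')) / 2) =
        (1 / 2 : ℝ) • ((fun z => rad g n (fun i => φ i - 2 * g i z)) +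
          fun _ => M fun z' => rad g n (fun i => φ i + 2 * g i z')) := by
      ext z
      simp only [Pi.add_apply, Pi.smul_apply, smul_eq_mul]
      ring
    have h6 := mixture_le hM (fun z => step_le_rad hg n hφ z)
    have e' : (fun z => (rad g n (fun i => φ i + 2 * g i z) +
        rad g n (fun i => φ i - 2 * g i z)) / 2) =
        (1 / 2 : ℝ) • ((fun z => rad g n (fun i => φ i + 2 * g i z)) +
          fun z => rad g n (fun i => φ i - 2 * g i z)) := by
      ext z
      simp only [Pi.add_apply, Pi.smul_apply, smul_eq_mul]
      ring
    rw [e, map_smul, map_add, mixture_const hM, smul_eq_mul] at h5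
    rw [e', map_smul, map_add, smul_eq_mul] at h6
    linarith

end Rad

/-! ### Averages over random signs and trees -/

/-- The expectation of `f ε` for `n` independent uniformly distributed signs `ε`. -/
noncomputable def signAvg (n : ℕ) (f : (Fin n → ℤˣ) → ℝ) : ℝ := (∑ ε, f ε) / 2 ^ n

lemma signAvg_zero (f : (Fin 0 → ℤˣ) → ℝ) : signAvg 0 f = f Fin.elim0 := by
  simp only [signAvg, Fintype.sum_unique, pow_zero, div_one]
  exact congrArg f (Subsingleton.elim _ _)

lemma signAvg_succ (n : ℕ) (f : (Fin (n + 1) → ℤˣ) → ℝ) :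
    signAvg (n + 1) f =
      (signAvg n (fun ε => f (Fin.cons 1 ε)) + signAvg n (fun ε => f (Fin.cons (-1) ε))) / 2 := by
  have h : ∑ ε, f ε =
      ∑ ε : Fin n → ℤˣ, f (Fin.cons 1 ε) + ∑ ε : Fin n → ℤˣ, f (Fin.cons (-1) ε) := by
    rw [← (Fin.consEquiv fun _ : Fin (n + 1) => ℤˣ).sum_comp f, Fintype.sum_prod_type]
    simp [Fin.consEquiv]
  rw [signAvg, h, signAvg, signAvg, pow_succ]
  field_simp

lemma signAvg_mono {n : ℕ} {f f' : (Fin n → ℤˣ) → ℝ} (h : ∀ ε, f ε ≤ f' ε) :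
    signAvg n f ≤ signAvg n f' := by
  unfold signAvg
  gcongr with ε
  exact h ε

lemma signAvg_const (n : ℕ) (c : ℝ) : signAvg n (fun _ => c) = c := by
  simp [signAvg]

lemma signAvg_add {n : ℕ} (f f' : (Fin n → ℤˣ) → ℝ) :
    signAvg n (fun ε => f ε + f' ε) = signAvg n f + signAvg n f' := by
  simp [signAvg, Finset.sum_add_distrib, add_div]

lemma signAvg_const_mul {n : ℕ} (c : ℝ) (f : (Fin n → ℤˣ) → ℝ) :
    signAvg n (fun ε => c * f ε) = c * signAvg n f := by
  simp [signAvg, ← Finset.mul_sum, mul_div_assoc]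

lemma signAvg_sum {n : ℕ} {J : Type*} (s : Finset J) (f : J → (Fin n → ℤˣ) → ℝ) :
    signAvg n (fun ε => ∑ j ∈ s, f j ε) = ∑ j ∈ s, signAvg n (f j) := by
  simp only [signAvg, ← Finset.sum_div]
  rw [Finset.sum_comm]

/-- The tree with root `z` whose subtree below the sign `e` is `w e`. -/
def treeCons {Z : Type*} {n : ℕ} (z : Z) (w : ℤˣ → SignTree Z n) : SignTree Z (n + 1) :=
  fun t => Fin.cases (motive := fun t : Fin (n + 1) => (Fin (t : ℕ) → ℤˣ) → Z) (fun _ => z)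
    (fun t p => w (p ⟨0, by simp⟩) t fun i => p ⟨i + 1, by simp⟩) t

/-- The subtree of `w` below the first sign `e`. -/
def treeTail {Z : Type*} {n : ℕ} (w : SignTree Z (n + 1)) (e : ℤˣ) : SignTree Z n :=
  fun t p => w t.succ (Fin.cons (α := fun _ => ℤˣ) e p : Fin ((t : ℕ) + 1) → ℤˣ)

lemma along_treeCons_zero {Z : Type*} {n : ℕ} (z : Z) (w : ℤˣ → SignTree Z n)
    (ε : Fin (n + 1) → ℤˣ) : (treeCons z w).along ε 0 = z := rfl

lemma along_treeCons_succ {Z : Type*} {n : ℕ} (z : Z) (w : ℤˣ → SignTree Z n) (e : ℤˣ)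
    (ε : Fin n → ℤˣ) (t : Fin n) :
    (treeCons z w).along (Fin.cons e ε) t.succ = (w e).along ε t := rfl

lemma along_cons_zero {Z : Type*} {n : ℕ} (w : SignTree Z (n + 1)) (e : ℤˣ) (ε : Fin n → ℤˣ) :
    w.along (Fin.cons e ε) 0 = w 0 Fin.elim0 := by
  unfold SignTree.along
  congr 1
  ext i
  exact i.elim0

lemma along_cons_succ {Z : Type*} {n : ℕ} (w : SignTree Z (n + 1)) (e : ℤˣ) (ε : Fin n → ℤˣ)
    (t : Fin n) : w.along (Fin.cons e ε) t.succ = (treeTail w e).along ε t := by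
  unfold SignTree.along treeTail
  congr 1
  funext i
  refine Fin.cases (motive := fun i : Fin ((t : ℕ) + 1) =>
    (Fin.cons e ε : Fin (n + 1) → ℤˣ) (Fin.castLE t.succ.isLt.le i) = (Fin.cons e
      (fun i => ε (Fin.castLE t.isLt.le i)) : Fin ((t : ℕ) + 1) → ℤˣ) i) rfl (fun j => rfl) i

/-- The functional `rad` is attained, up to `η`, on a single tree. -/
lemma exists_tree_rad_le {I Z : Type*} [Nonempty I] [Nonempty Z] {g : I → Z → ℝ}
    (hg : ∀ i z, g i z ∈ Set.Icc (0 : ℝ) 1) (n : ℕ) {φ : I → ℝ} (hφ : BddAbove (Set.range φ))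
    {η : ℝ} (hη : 0 < η) :
    ∃ z : SignTree Z n, rad g n φ ≤
      signAvg n (fun ε => ⨆ i, (φ i + 2 * ∑ t, ((ε t : ℤ) : ℝ) * g i (z.along ε t))) + η := by
  induction n generalizing φ η with
  | zero =>
    refine ⟨fun t => t.elim0, ?_⟩
    rw [signAvg_zero]
    simp [rad, hη.le]
  | succ n ih =>
    obtain ⟨z, hz⟩ := exists_lt_of_lt_ciSup (show rad g (n + 1) φ - η / 2 < ⨆ z,
      (rad g n (fun i => φ i + 2 * g i z) + rad g n (fun i => φ i - 2 * g i z)) / 2 by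
        rw [rad]; linarith)
    obtain ⟨w₁, hw₁⟩ := ih (bddAbove_add_two hg hφ z) (half_pos hη)
    obtain ⟨w₂, hw₂⟩ := ih (bddAbove_sub_two hg hφ z) (half_pos hη)
    refine ⟨treeCons z fun e => if e = 1 then w₁ else w₂, ?_⟩
    have hne : ((-1 : ℤˣ) = 1) = False := by simp
    rw [signAvg_succ]
    simp only [Fin.sum_univ_succ, along_treeCons_zero, along_treeCons_succ, Fin.cons_zero,
      Fin.cons_succ, hne, if_true, if_false]
    have e1 : (fun ε : Fin n → ℤˣ => ⨆ i, φ i + 2 * ((((1 : ℤˣ) : ℤ) : ℝ) * g i z +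
        ∑ t, ((ε t : ℤ) : ℝ) * g i (w₁.along ε t))) =
        fun ε => ⨆ i, φ i + 2 * g i z + 2 * ∑ t, ((ε t : ℤ) : ℝ) * g i (w₁.along ε t) := by
      funext ε
      refine congrArg _ (funext fun i => ?_)
      push_cast
      ring
    have e2 : (fun ε : Fin n → ℤˣ => ⨆ i, φ i + 2 * ((((-1 : ℤˣ) : ℤ) : ℝ) * g i z +
        ∑ t, ((ε t : ℤ) : ℝ) * g i (w₂.along ε t))) =
        fun ε => ⨆ i, φ i - 2 * g i z + 2 * ∑ t, ((ε t : ℤ) : ℝ) * g i (w₂.along ε t) := by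
      funext ε
      refine congrArg _ (funext fun i => ?_)
      push_cast
      ring
    rw [e1, e2]
    linarith

/-! ### Chaining -/

/-- The Hoeffding bound for the moment generating function of a predictable sign sum. -/
lemma signAvg_exp_le {n : ℕ} (w : SignTree ℝ n) {c : ℝ} (hw : ∀ ε t, |w.along ε t| ≤ c) :
    signAvg n (fun ε => Real.exp (∑ t, ((ε t : ℤ) : ℝ) * w.along ε t)) ≤
      Real.exp (n * (c ^ 2 / 2)) := by
  induction n with
  | zero => simp [signAvg_zero]
  | succ n ih =>
    have h1 : ∀ e, signAvg n (fun ε => Real.exp (∑ t, ((ε t : ℤ) : ℝ) *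
        (treeTail w e).along ε t)) ≤ Real.exp (n * (c ^ 2 / 2)) := fun e =>
      ih _ fun ε t => by rw [← along_cons_succ]; exact hw _ _
    rw [signAvg_succ]
    simp only [Fin.sum_univ_succ, along_cons_zero, along_cons_succ, Fin.cons_zero,
      Fin.cons_succ, Real.exp_add, signAvg_const_mul]
    set x := w 0 Fin.elim0 with hx
    have hxc : x ^ 2 ≤ c ^ 2 := by
      have := hw (Fin.cons 1 fun _ => 1) 0
      rw [along_cons_zero] at this
      exact sq_le_sq' (by linarith [neg_abs_le x]) ((le_abs_self x).trans this)
    have h2 := mul_le_mul_of_nonneg_left (h1 1) (Real.exp_nonneg x)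
    have h3 := mul_le_mul_of_nonneg_left (h1 (-1)) (Real.exp_nonneg (-x))
    have h4 : Real.cosh x ≤ Real.exp (c ^ 2 / 2) :=
      (Real.cosh_le_exp_half_sq x).trans (Real.exp_le_exp.2 (by linarith))
    have h5 := mul_le_mul_of_nonneg_right h4 (Real.exp_nonneg (n * (c ^ 2 / 2)))
    rw [← Real.exp_add] at h5
    rw [Real.cosh_eq] at h5
    have e : c ^ 2 / 2 + n * (c ^ 2 / 2) = ((n + 1 : ℕ) : ℝ) * (c ^ 2 / 2) := by
      push_cast; ring
    rw [e] at h5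
    have e1 : (((1 : ℤˣ) : ℤ) : ℝ) * x = x := by push_cast; ring
    have e2 : (((-1 : ℤˣ) : ℤ) : ℝ) * x = -x := by push_cast; ring
    rw [e1, e2]
    linarith

lemma le_two_mul_sqrt_of_forall {x A B : ℝ} (hA : 0 ≤ A) (hB : 0 ≤ B)
    (h : ∀ l : ℝ, 0 < l → x ≤ A / l + l * B) : x ≤ 2 * (Real.sqrt A * Real.sqrt B) := by
  refine le_of_forall_pos_le_add fun κ hκ => ?_
  set a := Real.sqrt A
  set b := Real.sqrt B
  have ha : 0 ≤ a := Real.sqrt_nonneg A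
  have hb : 0 ≤ b := Real.sqrt_nonneg B
  have hA' : A = a * a := (Real.mul_self_sqrt hA).symm
  have hB' : B = b * b := (Real.mul_self_sqrt hB).symm
  -- The optimal `l = a / b` may be degenerate, so both entries are shifted by a small amount.
  set s := κ / (a + b + 1) with hs
  have hs0 : 0 < s := by positivity
  have h1 := h ((a + s) / (b + s)) (by positivity)
  have h2 : A / ((a + s) / (b + s)) ≤ a * (b + s) := by
    rw [div_div_eq_mul_div, div_le_iff₀ (by positivity), hA']
    have : 0 ≤ a * (b + s) * s := by positivity
    linarith
  have h3 : (a + s) / (b + s) * B ≤ (a + s) * b := by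
    rw [div_mul_eq_mul_div, div_le_iff₀ (by positivity), hB']
    have : 0 ≤ (a + s) * b * s := by positivity
    linarith
  have h4 : s * (a + b) ≤ κ := by
    rw [hs, div_mul_eq_mul_div, div_le_iff₀ (by positivity)]
    nlinarith
  linarith

/-- The maximal inequality for finitely many predictable sign sums. -/
lemma signAvg_iSup_le {T : ℕ} {J : Type*} [Fintype J] [Nonempty J] (w : J → SignTree ℝ T) {c : ℝ}
    (hc : 0 ≤ c) (hw : ∀ j ε t, |(w j).along ε t| ≤ c) {N : ℝ} (hN : (Fintype.card J : ℝ) ≤ N) :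
    signAvg T (fun ε => ⨆ j, ∑ t, ((ε t : ℤ) : ℝ) * (w j).along ε t) ≤
      c * Real.sqrt (2 * T * Real.log N) := by
  have hJ : (1 : ℝ) ≤ Fintype.card J := by exact_mod_cast Fintype.card_pos
  have hN0 : 0 < N := by linarith
  have hlog : 0 ≤ Real.log N := Real.log_nonneg (by linarith)
  have key : ∀ l : ℝ, 0 < l →
      signAvg T (fun ε => ⨆ j, ∑ t, ((ε t : ℤ) : ℝ) * (w j).along ε t) ≤
        Real.log N / l + l * (T * (c ^ 2 / 2)) := by
    intro l hl
    set a := Real.log N + T * ((l * c) ^ 2 / 2) with ha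
    have hpt : ∀ ε : Fin T → ℤˣ, (⨆ j, ∑ t, ((ε t : ℤ) : ℝ) * (w j).along ε t) ≤
        (1 / l) * (Real.exp (-a) * (∑ j, Real.exp (∑ t, ((ε t : ℤ) : ℝ) *
          (l * (w j).along ε t))) + (a - 1)) := by
      intro ε
      refine ciSup_le fun j => ?_
      rw [one_div, ← div_eq_inv_mul, le_div_iff₀ hl]
      set X := ∑ t, ((ε t : ℤ) : ℝ) * (w j).along ε t with hX
      have h1 : Real.exp (X * l) ≤
          ∑ j, Real.exp (∑ t, ((ε t : ℤ) : ℝ) * (l * (w j).along ε t)) := by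
        refine le_trans (le_of_eq ?_) (Finset.single_le_sum (f := fun j =>
          Real.exp (∑ t, ((ε t : ℤ) : ℝ) * (l * (w j).along ε t)))
          (fun j _ => Real.exp_nonneg _) (Finset.mem_univ j))
        rw [hX, Finset.sum_mul]
        exact congrArg _ (Finset.sum_congr rfl fun t _ => by ring)
      have h2 := Real.add_one_le_exp (-a + X * l)
      rw [Real.exp_add] at h2
      have h3 := mul_le_mul_of_nonneg_left h1 (Real.exp_nonneg (-a))
      linarith
    refine (signAvg_mono hpt).trans ?_
    rw [signAvg_const_mul, signAvg_add, signAvg_const_mul, signAvg_const, signAvg_sum]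
    have h4 : ∑ j, signAvg T (fun ε => Real.exp (∑ t, ((ε t : ℤ) : ℝ) *
        (l * (w j).along ε t))) ≤ N * Real.exp (T * ((l * c) ^ 2 / 2)) := by
      refine (Finset.sum_le_card_nsmul _ _ (Real.exp (T * ((l * c) ^ 2 / 2))) fun j _ => ?_).trans
        ?_
      · refine signAvg_exp_le (fun t p => l * w j t p) fun ε t => ?_
        change |l * (w j).along ε t| ≤ _
        rw [abs_mul, abs_of_pos hl]
        exact mul_le_mul_of_nonneg_left (hw j ε t) hl.le
      · rw [nsmul_eq_mul]
        exact mul_le_mul_of_nonneg_right hN (Real.exp_nonneg _)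
    have h5 : N * Real.exp (T * ((l * c) ^ 2 / 2)) = Real.exp a := by
      rw [ha, Real.exp_add, Real.exp_log hN0]
    rw [h5] at h4
    have h6 := mul_le_mul_of_nonneg_left h4 (Real.exp_nonneg (-a))
    rw [← Real.exp_add, neg_add_cancel, Real.exp_zero] at h6
    have h7 : Real.log N / l + l * (T * (c ^ 2 / 2)) = (1 / l) * a := by
      rw [ha]; field_simp
    rw [h7]
    exact mul_le_mul_of_nonneg_left (by linarith) (by positivity)
  refine (le_two_mul_sqrt_of_forall hlog (by positivity) key).trans (le_of_eq ?_)
  have e1 : (T : ℝ) * (c ^ 2 / 2) = c ^ 2 * (T / 2) := by ring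
  have e2 : 2 * (T : ℝ) * Real.log N = 2 ^ 2 * (Real.log N * (T / 2)) := by ring
  rw [e1, e2, Real.sqrt_mul (by positivity), Real.sqrt_sq hc, Real.sqrt_mul (by positivity),
    Real.sqrt_sq (by norm_num), Real.sqrt_mul hlog]
  ring

/-- Truncation to `[-c, c]`. Truncating the difference of two trees keeps it a tree and makes it
bounded on every path; on the paths where the two trees are close nothing changes. -/
noncomputable def clip (c x : ℝ) : ℝ := max (-c) (min c x)

lemma abs_clip_le {c : ℝ} (hc : 0 ≤ c) (x : ℝ) : |clip c x| ≤ c :=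
  abs_le.2 ⟨le_max_left _ _, max_le (by linarith) (min_le_left _ _)⟩

lemma clip_of_abs_le {c x : ℝ} (h : |x| ≤ c) : clip c x = x := by
  rw [clip, min_eq_right (abs_le.1 h).2, max_eq_right (abs_le.1 h).1]

/-- Chaining along a fixed tree, through the scales `β₀ 2 ^ k` for `k ≤ K`, where the coarsest
scale is covered by a constant. -/
lemma signAvg_iSup_le_chaining {I Z : Type*} [Nonempty I] {g : I → Z → ℝ} {T : ℕ}
    (z : SignTree Z T) {β₀ : ℝ} (hβ₀ : 0 < β₀) (K : ℕ) (V : ℕ → Finset (SignTree ℝ T)) (N : ℕ → ℕ)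
    (hV : ∀ k ≤ K, ∀ i ε, ∃ v ∈ V k, ∀ t, |v.along ε t - g i (z.along ε t)| ≤ β₀ * 2 ^ k)
    (hlast : V K = {fun _ _ => 1 / 2}) (hcard : ∀ k ≤ K, (V k).card ≤ N k)
    (hN : ∀ k < K, N (k + 1) ≤ N k) :
    signAvg T (fun ε => ⨆ i, (0 + 2 * ∑ t, ((ε t : ℤ) : ℝ) * g i (z.along ε t))) ≤
      2 * T * β₀ + ∑ k ∈ Finset.range K, 12 * (β₀ * 2 ^ k) * Real.sqrt (T * Real.log (N k)) := by
  set β : ℕ → ℝ := fun k => β₀ * 2 ^ k with hβ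
  have hβpos : ∀ k, 0 < β k := fun k => by positivity
  have hβsucc : ∀ k, β (k + 1) = 2 * β k := fun k => by simp only [hβ, pow_succ]; ring
  let d : (k : ℕ) → (V k × V (k + 1)) → SignTree ℝ T := fun k p t q =>
    clip (3 * β k) ((p.1 : SignTree ℝ T) t q - (p.2 : SignTree ℝ T) t q)
  let m : ℕ → (Fin T → ℤˣ) → ℝ := fun k ε => ⨆ p, ∑ t, ((ε t : ℤ) : ℝ) * (d k p).along ε t
  have hpath : ∀ ε i n k, k + n = K → ∀ v ∈ V k, (∀ t, |v.along ε t - g i (z.along ε t)| ≤ β k) →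
      ∑ t, ((ε t : ℤ) : ℝ) * v.along ε t ≤
        ∑ j ∈ Finset.Ico k K, m j ε + ∑ t, ((ε t : ℤ) : ℝ) * (1 / 2) := by
    intro ε i n
    induction n with
    | zero =>
      intro k hk v hv _
      obtain rfl : k = K := by simpa using hk
      rw [hlast, Finset.mem_singleton] at hv
      subst hv
      simp [SignTree.along]
    | succ n ih =>
      intro k hk v hv hvg
      obtain ⟨v', hv', hvg'⟩ := hV (k + 1) (by omega) i ε
      have h1 := ih (k + 1) (by omega) v' hv' hvg'
      rw [Finset.sum_eq_sum_Ico_succ_bot (by omega : k < K)]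
      have h2 : ∑ t, ((ε t : ℤ) : ℝ) * (d k (⟨v, hv⟩, ⟨v', hv'⟩)).along ε t ≤ m k ε :=
        le_ciSup (f := fun p => ∑ t, ((ε t : ℤ) : ℝ) * (d k p).along ε t)
          (Set.finite_range _).bddAbove _
      have h3 : ∀ t, (d k (⟨v, hv⟩, ⟨v', hv'⟩)).along ε t = v.along ε t - v'.along ε t := by
        intro t
        refine clip_of_abs_le ?_
        have h4 := hvg t
        have h5 := hvg' t
        have h6 := hβsucc k
        rw [abs_le] at h4 h5 ⊢
        change -(3 * β k) ≤ v.along ε t - v'.along ε t ∧ v.along ε t - v'.along ε t ≤ 3 * β k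
        change -β (k + 1) ≤ _ ∧ _ ≤ β (k + 1) at h5
        constructor <;> linarith [h4.1, h4.2, h5.1, h5.2]
      simp only [h3, mul_sub, Finset.sum_sub_distrib] at h2
      linarith
  have hsup : ∀ ε : Fin T → ℤˣ, (⨆ i, (0 + 2 * ∑ t, ((ε t : ℤ) : ℝ) * g i (z.along ε t))) ≤
      2 * (T * β₀ + (∑ k ∈ Finset.range K, m k ε + ∑ t, ((ε t : ℤ) : ℝ) * (1 / 2))) := by
    intro ε
    refine ciSup_le fun i => ?_
    obtain ⟨v, hv, hvg⟩ := hV 0 K.zero_le i ε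
    have h1 := hpath ε i K 0 (by simp) v hv hvg
    rw [← Finset.range_eq_Ico] at h1
    have h2 : ∑ t, ((ε t : ℤ) : ℝ) * g i (z.along ε t) - ∑ t, ((ε t : ℤ) : ℝ) * v.along ε t ≤
        T * β₀ := by
      rw [← Finset.sum_sub_distrib]
      refine (Finset.sum_le_card_nsmul _ _ β₀ fun t _ => ?_).trans (by simp)
      have h3 := hvg t
      rw [pow_zero, mul_one, abs_le] at h3
      rcases Int.units_eq_one_or (ε t) with h | h <;> rw [h] <;> push_cast <;> linarith [h3.1, h3.2]
    linarith
  have hsign : ∀ n, signAvg n (fun ε => ∑ t, ((ε t : ℤ) : ℝ) * (1 / 2)) = 0 := by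
    intro n
    induction n with
    | zero => simp [signAvg_zero]
    | succ n ih =>
      rw [signAvg_succ]
      simp only [Fin.sum_univ_succ, Fin.cons_zero, Fin.cons_succ, signAvg_add, signAvg_const, ih]
      push_cast
      ring
  have hm : ∀ k < K, signAvg T (m k) ≤ 6 * β k * Real.sqrt (T * Real.log (N k)) := by
    intro k hk
    have hne : Nonempty (V k × V (k + 1)) := by
      obtain ⟨v, hv, _⟩ := hV k hk.le (Classical.arbitrary I) fun _ => 1
      obtain ⟨v', hv', _⟩ := hV (k + 1) hk (Classical.arbitrary I) fun _ => 1
      exact ⟨(⟨v, hv⟩, ⟨v', hv'⟩)⟩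
    have h1 := signAvg_iSup_le (d k) (c := 3 * β k) (by linarith [hβpos k])
      (fun j ε t => abs_clip_le (by linarith [hβpos k]) _) (N := (N k : ℝ) ^ 2) (by
        rw [Fintype.card_prod, Fintype.card_coe, Fintype.card_coe, pow_two]
        exact_mod_cast Nat.mul_le_mul (hcard k hk.le) ((hcard (k + 1) hk).trans (hN k hk)))
    refine h1.trans (le_of_eq ?_)
    have e : 2 * (T : ℝ) * Real.log ((N k : ℝ) ^ 2) = 2 ^ 2 * (T * Real.log (N k)) := by
      rw [Real.log_pow]; push_cast; ring
    rw [e, Real.sqrt_mul (by norm_num), Real.sqrt_sq (by norm_num)]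
    ring
  refine (signAvg_mono hsup).trans ?_
  rw [signAvg_const_mul, signAvg_add, signAvg_add, signAvg_const, signAvg_sum, hsign]
  have h7 := Finset.sum_le_sum fun k hk => hm k (Finset.mem_range.1 hk)
  have h8 : ∑ k ∈ Finset.range K, 12 * (β₀ * 2 ^ k) * Real.sqrt (T * Real.log (N k)) =
      2 * ∑ k ∈ Finset.range K, 6 * β k * Real.sqrt (T * Real.log (N k)) := by
    rw [Finset.mul_sum]
    exact Finset.sum_congr rfl fun k _ => by ring
  rw [h8]
  linarith

/-! ### Covering numbers and the entropy integral -/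

section Entropy

variable {F X : Type*} (loss : F → X → ℝ) (Ψ : Set (F → F)) (T : ℕ)

lemma IsCover.mono {loss : F → X → ℝ} {Ψ : Set (F → F)} {T : ℕ} {δ δ' : ℝ} (h : δ ≤ δ')
    {z : SignTree (F × X) T} {V : Set (SignTree ℝ T)} (hV : IsCover loss Ψ δ z V) :
    IsCover loss Ψ δ' z V := fun ψ hψ ε => by
  obtain ⟨v, hv, hv'⟩ := hV ψ hψ ε
  exact ⟨v, hv, fun t => (hv' t).trans h⟩

lemma antitone_coveringNumber : Antitone (coveringNumber loss Ψ T) := fun _ _ h =>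
  iSup_mono fun _ => iInf_mono fun _ => iInf_mono' fun hV => ⟨hV.mono h, le_rfl⟩

lemma antitone_rootEntropy : Antitone (rootEntropy loss Ψ T) := fun _ _ h => by
  unfold rootEntropy
  refine ENNReal.rpow_le_rpow (ENNReal.div_le_div_right (EReal.toENNReal_le_toENNReal
    (ENNReal.log_monotone ?_)) _) (by norm_num)
  exact ENat.toENNReal_le.2 (antitone_coveringNumber loss Ψ T h)

lemma exists_finset_cover {loss : F → X → ℝ} {Ψ : Set (F → F)} {T : ℕ} {δ : ℝ}
    (h : coveringNumber loss Ψ T δ ≠ ⊤) (z : SignTree (F × X) T) :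
    ∃ V : Finset (SignTree ℝ T), IsCover loss Ψ δ z V ∧
      V.card ≤ (coveringNumber loss Ψ T δ).toNat := by
  obtain ⟨n, hn⟩ := ENat.ne_top_iff_exists.1 h
  have h1 : (⨅ (V : Set (SignTree ℝ T)) (_ : IsCover loss Ψ δ z V), V.encard) < n + 1 := by
    rw [ENat.lt_add_one_iff (by simp), hn]
    exact le_iSup (fun z : SignTree (F × X) T =>
      ⨅ (V : Set (SignTree ℝ T)) (_ : IsCover loss Ψ δ z V), V.encard) z
  obtain ⟨V, hV⟩ := iInf_lt_iff.1 h1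
  obtain ⟨hVc, hV⟩ := iInf_lt_iff.1 hV
  rw [ENat.lt_add_one_iff (by simp)] at hV
  have hfin : V.Finite := Set.encard_lt_top_iff.1 (hV.trans_lt (by simp))
  refine ⟨hfin.toFinset, by simpa using hVc, ?_⟩
  rw [hfin.encard_eq_coe_toFinset_card] at hV
  rw [← hn]
  exact_mod_cast hV

lemma ofReal_sqrt_le_rootEntropy {T : ℕ} (hT : 1 ≤ T) {δ : ℝ} {n : ℕ} (hn : 1 ≤ n)
    (h : (n : ℕ∞) ≤ coveringNumber loss Ψ T δ) :
    ENNReal.ofReal (Real.sqrt (Real.log n / T)) ≤ rootEntropy loss Ψ T δ := by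
  have hT' : (0 : ℝ) < T := by exact_mod_cast hT
  have hn' : (1 : ℝ) ≤ n := by exact_mod_cast hn
  have hlog : 0 ≤ Real.log n / T := div_nonneg (Real.log_nonneg hn') hT'.le
  have h1 : ((n : ℕ∞) : ℝ≥0∞) ≤ (coveringNumber loss Ψ T δ : ℝ≥0∞) := ENat.toENNReal_le.2 h
  have h2 := EReal.toENNReal_le_toENNReal (ENNReal.log_monotone h1)
  rw [ENat.toENNReal_coe, ← ENNReal.ofReal_natCast, ENNReal.log_ofReal_of_pos (by linarith),
    EReal.real_coe_toENNReal] at h2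
  unfold rootEntropy
  rw [Real.sqrt_eq_rpow, ← ENNReal.ofReal_rpow_of_nonneg hlog (by norm_num),
    ENNReal.ofReal_div_of_pos hT', ENNReal.ofReal_natCast]
  exact ENNReal.rpow_le_rpow (ENNReal.div_le_div_right h2 _) (by norm_num)

lemma rootEntropy_eq_top {T : ℕ} {δ : ℝ} (h : coveringNumber loss Ψ T δ = ⊤) :
    rootEntropy loss Ψ T δ = ⊤ := by
  unfold rootEntropy
  rw [h, ENat.toENNReal_top, ENNReal.log_top, EReal.toENNReal_top,
    ENNReal.top_div_of_ne_top (by simp), ENNReal.top_rpow_of_pos (by norm_num)]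

/-- The integral of an antitone function is bounded from below by its dyadic lower sums. -/
lemma sum_dyadic_le_lintegral {f : ℝ → ℝ≥0∞} (hf : Antitone f) {α : ℝ} (hα : 0 < α) (K : ℕ) :
    ∑ k ∈ Finset.range K, ENNReal.ofReal (α * 2 ^ k) * f (2 * α * 2 ^ k) ≤
      ∫⁻ δ in Set.Ioc α (α * 2 ^ K), f δ := by
  induction K with
  | zero => simp
  | succ K ih =>
    have hle : α ≤ α * 2 ^ K := le_mul_of_one_le_right hα.le (one_le_pow₀ (by norm_num))
    have hle' : α * 2 ^ K ≤ α * 2 ^ (K + 1) := by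
      rw [pow_succ]
      nlinarith [show 0 < α * 2 ^ K by positivity]
    rw [Finset.sum_range_succ, ← Set.Ioc_union_Ioc_eq_Ioc hle hle', lintegral_union
      measurableSet_Ioc (Set.Ioc_disjoint_Ioc_of_le le_rfl)]
    refine add_le_add ih ?_
    calc ENNReal.ofReal (α * 2 ^ K) * f (2 * α * 2 ^ K)
        = ∫⁻ _ in Set.Ioc (α * 2 ^ K) (α * 2 ^ (K + 1)), f (2 * α * 2 ^ K) := by
          rw [lintegral_const, Measure.restrict_apply_univ, Real.volume_Ioc, mul_comm]
          congr 2
          ring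
      _ ≤ _ := by
          refine setLIntegral_mono' measurableSet_Ioc fun δ hδ => hf ?_
          have := hδ.2
          rw [pow_succ] at this
          linarith

/-- The chaining bound: the sequential Rademacher average is controlled by the entropy integral.
Aligning the finest dyadic scale with `2 α` makes the constant in front of `α` small enough to pay
for the symmetrization as well as for the slack of the approximate minimax theorem. -/
lemma rad_le_entropyIntegral [Nonempty F] [Nonempty X]
    (hloss : ∀ f x, loss f x ∈ Set.Icc (0 : ℝ) 1) (hΨ : Ψ.Nonempty) (hT : 1 ≤ T) :
    ENNReal.ofReal (rad (fun (i : Ψ) (z : F × X) => loss (i.1 z.1) z.2) T (fun _ => 0) / (4 * T)) ≤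
      entropyIntegral loss Ψ T := by
  have : Nonempty Ψ := hΨ.to_subtype
  have hT' : (0 : ℝ) < T := by exact_mod_cast hT
  set g : Ψ → F × X → ℝ := fun i z => loss (i.1 z.1) z.2 with hgdef
  have hg : ∀ i z, g i z ∈ Set.Icc (0 : ℝ) 1 := fun i z => hloss _ _
  refine le_iInf₂ fun α hα => ?_
  have hex : ∃ K : ℕ, 1 / 2 ≤ 2 * α * 2 ^ K := by
    obtain ⟨K, hK⟩ := pow_unbounded_of_one_lt (1 / (4 * α)) (by norm_num : (1 : ℝ) < 2)
    refine ⟨K, ?_⟩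
    rw [div_lt_iff₀ (by positivity)] at hK
    linarith
  obtain ⟨K, hK, hKmin⟩ : ∃ K : ℕ, 1 / 2 ≤ 2 * α * 2 ^ K ∧ ∀ k < K, 2 * α * 2 ^ k < 1 / 2 := by
    classical
    exact ⟨Nat.find hex, Nat.find_spec hex, fun k hk => not_le.1 (Nat.find_min hex hk)⟩
  set β : ℕ → ℝ := fun k => 2 * α * 2 ^ k with hβ
  have hint : ∑ k ∈ Finset.range K, ENNReal.ofReal (α * 2 ^ k) * rootEntropy loss Ψ T (β k) ≤
      ∫⁻ δ in Set.Icc α 2, rootEntropy loss Ψ T δ := by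
    rcases Nat.eq_zero_or_pos K with h0 | hpos
    · simp [h0]
    · refine (sum_dyadic_le_lintegral (antitone_rootEntropy loss Ψ T) hα K).trans ?_
      refine lintegral_mono_set fun δ hδ => ⟨hδ.1.le, hδ.2.trans ?_⟩
      have h1 := hKmin (K - 1) (by omega)
      have h2 : (2 : ℝ) ^ K = 2 ^ (K - 1) * 2 := by
        rw [← pow_succ, Nat.sub_add_cancel hpos]
      rw [h2]
      linarith
  by_cases htop : ∃ k < K, coveringNumber loss Ψ T (β k) = ⊤
  · obtain ⟨k, hk, htop⟩ := htop
    have h1 : (⊤ : ℝ≥0∞) ≤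
        ∑ k ∈ Finset.range K, ENNReal.ofReal (α * 2 ^ k) * rootEntropy loss Ψ T (β k) := by
      refine le_trans (le_of_eq ?_) (Finset.single_le_sum (f := fun k =>
        ENNReal.ofReal (α * 2 ^ k) * rootEntropy loss Ψ T (β k)) (fun _ _ => zero_le)
        (Finset.mem_range.2 hk))
      rw [rootEntropy_eq_top loss Ψ htop, ENNReal.mul_top]
      simpa using (by positivity : 0 < α * 2 ^ k)
    rw [top_le_iff.1 (h1.trans hint), ENNReal.mul_top (by simp), add_top]
    exact le_top
  · push Not at htop
    let N : ℕ → ℕ := fun k => if k < K then (coveringNumber loss Ψ T (β k)).toNat else 1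
    have hNk : ∀ k < K, (N k : ℕ∞) = coveringNumber loss Ψ T (β k) := by
      intro k hk
      simp only [N, if_pos hk]
      exact ENat.natCast_toNat (htop k hk)
    have hN1 : ∀ k, 1 ≤ N k := by
      intro k
      by_cases hk : k < K
      · obtain ⟨V, hV, hVc⟩ := exists_finset_cover (htop k hk)
          (fun _ _ => (Classical.arbitrary F, Classical.arbitrary X))
        obtain ⟨ψ, hψ⟩ := hΨ
        obtain ⟨v, hv, -⟩ := hV ψ hψ fun _ => 1
        simp only [N, if_pos hk]
        exact (Finset.card_pos.2 ⟨v, hv⟩).trans_le hVc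
      · simp [N, hk]
    have hNanti : ∀ k < K, N (k + 1) ≤ N k := by
      intro k hk
      by_cases hk' : k + 1 < K
      · have h1 : (N (k + 1) : ℕ∞) ≤ N k := by
          rw [hNk k hk, hNk _ hk']
          refine antitone_coveringNumber loss Ψ T ?_
          simp only [hβ, pow_succ]
          nlinarith [show 0 < 2 * α * 2 ^ k by positivity]
        exact_mod_cast h1
      · simpa [N, hk'] using hN1 k
    have hrad : rad g T (fun _ => 0) ≤ 2 * T * (2 * α) +
        ∑ k ∈ Finset.range K, 12 * β k * Real.sqrt (T * Real.log (N k)) := by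
      refine le_of_forall_pos_le_add fun η hη => ?_
      obtain ⟨z, hz⟩ := exists_tree_rad_le hg T (φ := fun _ => 0) (bddAbove_range_const 0) hη
      refine hz.trans (add_le_add_left ?_ η)
      have hcov : ∀ k, ∃ V : Finset (SignTree ℝ T), (k < K → IsCover loss Ψ (β k) z V) ∧
          (¬ k < K → V = {fun _ _ => 1 / 2}) ∧ V.card ≤ N k := by
        intro k
        by_cases hk : k < K
        · obtain ⟨V, hV, hVc⟩ := exists_finset_cover (htop k hk) z
          exact ⟨V, fun _ => hV, fun h => absurd hk h, by simpa [N, hk] using hVc⟩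
        · exact ⟨{fun _ _ => 1 / 2}, fun h => absurd h hk, fun _ => rfl, by simp [N, hk]⟩
      choose V hV1 hV2 hV3 using hcov
      refine signAvg_iSup_le_chaining z (by linarith) K V N ?_ (hV2 K (lt_irrefl K))
        (fun k _ => hV3 k) hNanti
      intro k hk i ε
      rcases hk.lt_or_eq with hk | rfl
      · exact hV1 k hk i.1 i.2 ε
      · refine ⟨_, by rw [hV2 k (lt_irrefl k)]; exact Finset.mem_singleton_self _, fun t => ?_⟩
        have h1 := hg i (z.along ε t)
        change |1 / 2 - _| ≤ _
        refine le_trans ?_ hK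
        rw [abs_le]
        constructor <;> linarith [h1.1, h1.2]
    have hreal : rad g T (fun _ => 0) / (4 * T) ≤ α +
        6 * Real.sqrt 2 * ∑ k ∈ Finset.range K, (α * 2 ^ k) * Real.sqrt (Real.log (N k) / T) := by
      rw [div_le_iff₀ (by positivity)]
      refine hrad.trans ?_
      have h2 : ∀ k, 12 * β k * Real.sqrt (T * Real.log (N k)) ≤
          6 * Real.sqrt 2 * ((α * 2 ^ k) * Real.sqrt (Real.log (N k) / T)) * (4 * T) := by
        intro k
        have h3 : Real.sqrt (T * Real.log (N k)) = T * Real.sqrt (Real.log (N k) / T) := by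
          have e : T * Real.log (N k) = (T : ℝ) ^ 2 * (Real.log (N k) / T) := by field_simp
          rw [e, Real.sqrt_mul (by positivity), Real.sqrt_sq hT'.le]
        have h4 : 1 ≤ Real.sqrt 2 := Real.one_le_sqrt.2 (by norm_num)
        have h5 : 0 ≤ 24 * ((α * 2 ^ k) * (T * Real.sqrt (Real.log (N k) / T))) := by positivity
        rw [h3]
        simp only [hβ]
        nlinarith
      have h6 := Finset.sum_le_sum fun k (_ : k ∈ Finset.range K) => h2 k
      rw [← Finset.sum_mul, ← Finset.mul_sum] at h6
      linarith
    refine (ENNReal.ofReal_le_ofReal hreal).trans ?_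
    rw [ENNReal.ofReal_add hα.le (by positivity), ENNReal.ofReal_mul (by positivity),
      ENNReal.ofReal_sum_of_nonneg (fun k _ => by positivity)]
    gcongr
    refine le_trans (Finset.sum_le_sum fun k hk => ?_) hint
    rw [ENNReal.ofReal_mul (by positivity)]
    gcongr
    exact ofReal_sqrt_le_rootEntropy loss Ψ hT (hN1 k) (hNk k (Finset.mem_range.1 hk)).le

end Entropy

/-! ### Stationary mixtures and outer expectations -/

/-- The Markov chain that moves `f` to `act i f` with `i` drawn from `L` has an approximately
stationary mixture, a Cesàro mean of its laws. -/
lemma exists_stationary_mixture {F I : Type*} [Nonempty F] (act : I → F → F)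
    {L : (I → ℝ) →ₗ[ℝ] ℝ} (hL : L ∈ mixtures I) {η : ℝ} (hη : 0 < η) :
    ∃ Q ∈ mixtures F, ∀ h : F → ℝ, (∀ f, h f ∈ Set.Icc (0 : ℝ) 1) →
      Q h - Q (fun f => L fun i => h (act i f)) ≤ η := by
  let P : (F → ℝ) →ₗ[ℝ] (F → ℝ) :=
    { toFun := fun h f => L fun i => h (act i f)
      map_add' := fun h h' => funext fun f =>
        map_add L (fun i => h (act i f)) (fun i => h' (act i f))
      map_smul' := fun c h => funext fun f => map_smul L c (fun i => h (act i f)) }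
  have hP : ∀ (k : ℕ) (f : F),
      (LinearMap.proj f : (F → ℝ) →ₗ[ℝ] ℝ).comp (P ^ k) ∈ mixtures F := by
    intro k
    induction k with
    | zero => intro f; exact proj_mem_mixtures f
    | succ k ih =>
      intro f
      rw [pow_succ']
      let N : (F → ℝ) →ₗ[ℝ] (I → ℝ) := LinearMap.pi fun i => (LinearMap.proj (act i f)).comp (P ^ k)
      exact mixture_bind hL (N := N) fun i => ih (act i f)
  obtain ⟨n, hn⟩ := exists_nat_gt (1 / η)
  have hn0 : (0 : ℝ) < n := lt_trans (by positivity) hn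
  let f₀ := Classical.arbitrary F
  refine ⟨∑ k ∈ Finset.range n, (1 / n : ℝ) • (LinearMap.proj f₀ : (F → ℝ) →ₗ[ℝ] ℝ).comp (P ^ k),
    (convex_mixtures F).sum_mem (fun _ _ => by positivity) (by simp [hn0.ne']) fun k _ => hP k f₀,
    fun h hh => ?_⟩
  have e : (fun f => L fun i => h (act i f)) = P h := rfl
  rw [e]
  simp only [LinearMap.sum_apply, LinearMap.smul_apply, LinearMap.comp_apply, smul_eq_mul]
  have h1 : ∀ k, (P ^ k) (P h) = (P ^ (k + 1)) h := fun k => by rw [pow_succ]; rfl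
  simp only [h1, LinearMap.proj_apply]
  rw [← Finset.sum_sub_distrib]
  simp only [← mul_sub]
  rw [← Finset.mul_sum, Finset.sum_range_sub']
  have h2 : 0 ≤ (P ^ n) h f₀ := mixture_nonneg (hP n f₀) fun f => (hh f).1
  have h3 : (P ^ 0) h f₀ ≤ 1 := (hh f₀).2
  rw [div_lt_iff₀ hη] at hn
  rw [one_div, ← div_eq_inv_mul, div_le_iff₀ hn0]
  linarith

/-- A weighted form of `exists_stationary_mixture`, with total weight possibly zero. -/
lemma exists_stationary_mixture_sum {F I E : Type*} [Nonempty F] [Fintype E] (act : I → F → F)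
    {L : E → (I → ℝ) →ₗ[ℝ] ℝ} (hL : ∀ e, L e ∈ mixtures I) {a : E → ℝ} (ha : ∀ e, 0 ≤ a e)
    {η : ℝ} (hη : 0 < η) :
    ∃ Q ∈ mixtures F, ∀ h : F → ℝ, (∀ f, h f ∈ Set.Icc (0 : ℝ) 1) →
      ∑ e, a e * (Q h - Q (fun f => L e fun i => h (act i f))) ≤ η * ∑ e, a e := by
  rcases (Finset.sum_nonneg fun e (_ : e ∈ Finset.univ) => ha e).eq_or_lt with h0 | hpos
  · obtain ⟨Q, hQ⟩ := mixtures_nonempty F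
    have hz : ∀ e, a e = 0 := fun e =>
      (Finset.sum_eq_zero_iff_of_nonneg fun e _ => ha e).1 h0.symm e (Finset.mem_univ e)
    exact ⟨Q, hQ, fun h _ => by simp [hz]⟩
  · have hmem : (∑ e, (a e / ∑ e, a e) • L e) ∈ mixtures I :=
      (convex_mixtures I).sum_mem (fun e _ => div_nonneg (ha e) hpos.le)
        (by rw [← Finset.sum_div, div_self hpos.ne']) fun e _ => hL e
    obtain ⟨Q, hQ, hQ'⟩ := exists_stationary_mixture act hmem hη
    refine ⟨Q, hQ, fun h hh => ?_⟩
    have h1 := hQ' h hh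
    have e1 : (fun f => (∑ e, (a e / ∑ e, a e) • L e) fun i => h (act i f)) =
        ∑ e, (a e / ∑ e, a e) • fun f => L e fun i => h (act i f) := by
      ext f
      simp [LinearMap.sum_apply, Finset.sum_apply]
    rw [e1, map_sum] at h1
    simp only [map_smul, smul_eq_mul] at h1
    simp only [mul_sub, Finset.sum_sub_distrib, ← Finset.sum_mul]
    have h2 := mul_le_mul_of_nonneg_right h1 hpos.le
    rw [sub_mul, Finset.sum_mul] at h2
    have e2 : ∀ e, a e / (∑ e, a e) * Q (fun f => L e fun i => h (act i f)) * ∑ e, a e =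
        a e * Q (fun f => L e fun i => h (act i f)) := by
      intro e
      field_simp
    simp only [e2] at h2
    linarith

lemma expectation_mono {F : Type*} [MeasurableSpace F] (μ : Measure F) {G G' : F → EReal}
    (h : ∀ f, G f ≤ G' f) : expectation μ G ≤ expectation μ G' :=
  iInf_mono fun _ => iInf_mono fun _ => iInf_mono fun _ =>
    iInf_mono' fun hh => ⟨fun f => (h f).trans (hh f), le_rfl⟩

lemma gameValue_mono {F X : Type*} [MeasurableSpace F] (n : ℕ)
    {R R' : (Fin n → F) → (Fin n → X) → EReal} (h : ∀ f x, R f x ≤ R' f x) :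
    gameValue n R ≤ gameValue n R' := by
  induction n with
  | zero => exact h _ _
  | succ n ih =>
    exact iInf_mono fun q => iSup_mono fun x => expectation_mono _ fun f => ih fun fs xs => h _ _

/-- Every mixture is the expectation functional of a probability measure, also for the outer
expectation of nonmeasurable functions: off the finite support the majorant may be constant. -/
lemma exists_probabilityMeasure_expectation_le {F : Type*} [MeasurableSpace F]
    [MeasurableSingletonClass F] {Q : (F → ℝ) →ₗ[ℝ] ℝ} (hQ : Q ∈ mixtures F) :
    ∃ q : ProbabilityMeasure F, ∀ (G : F → EReal) (B : F → ℝ), BddAbove (Set.range B) →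
      (∀ f, G f ≤ (B f : EReal)) → expectation (q : Measure F) G ≤ ((Q B : ℝ) : EReal) := by
  classical
  obtain ⟨ι, _, w, p, hw, hw1, hp, rfl⟩ := mem_convexHull_iff_exists_fintype.1 hQ
  choose a ha using hp
  let μ : Measure F := ∑ i, ENNReal.ofReal (w i) • Measure.dirac (a i)
  have hμ : IsProbabilityMeasure μ := by
    constructor
    simp only [μ, Measure.coe_finsetSum, Finset.sum_apply, Measure.smul_apply, measure_univ,
      smul_eq_mul, mul_one]
    rw [← ENNReal.ofReal_sum_of_nonneg fun i _ => hw i, hw1, ENNReal.ofReal_one]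
  refine ⟨⟨μ, hμ⟩, fun G B hB hG => ?_⟩
  obtain ⟨C, hC⟩ := hB
  let h : F → ℝ := fun f => if f ∈ Set.range a then B f else C
  have hmeas : Measurable h := by
    refine (measurable_const (a := C)).measurable_of_countable_ne
      ((Set.finite_range a).countable.mono fun f hf => ?_)
    by_contra hfa
    exact hf (by simp only [h, if_neg hfa])
  have hint : ∀ i ∈ Finset.univ, Integrable h (ENNReal.ofReal (w i) • Measure.dirac (a i)) :=
    fun i _ => (integrable_dirac (by simp)).smul_measure ENNReal.ofReal_ne_top
  have hmaj : ∀ f, G f ≤ (h f : EReal) := by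
    intro f
    by_cases hf : f ∈ Set.range a
    · simp only [h, if_pos hf]; exact hG f
    · simp only [h, if_neg hf]
      exact (hG f).trans (EReal.coe_le_coe_iff.2 (hC ⟨f, rfl⟩))
  have hval : ∫ f, h f ∂μ = (∑ i, w i • p i) B := by
    rw [integral_finsetSum_measure hint, LinearMap.sum_apply]
    refine Finset.sum_congr rfl fun i _ => ?_
    rw [integral_smul_measure, integral_dirac, ENNReal.toReal_ofReal (hw i), ← ha i]
    simp [h]
  rw [← hval]
  exact iInf_le_of_le h (iInf_le_of_le hmeas (iInf_le_of_le
    ((integrable_finsetSum_measure (μ := fun i => ENNReal.ofReal (w i) • Measure.dirac (a i))).2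
      hint) (iInf_le_of_le hmaj le_rfl)))

/-! ### The learner's potential -/

section Game

variable {T : ℕ}

/-- `y` if the time `t` lies in the interval `[e.1, e.2]`, and `0` otherwise. -/
noncomputable def gate (e : Fin T × Fin T) (t : ℕ) (y : ℝ) : ℝ :=
  if (e.1 : ℕ) ≤ t ∧ t ≤ e.2 then y else 0

/-- The number of times from `t` on that lie in the interval `[e.1, e.2]`. -/
def remaining (e : Fin T × Fin T) (t : ℕ) : ℕ := e.2 + 1 - max (e.1 : ℕ) t

/-- The learner's bound, at time `t`, on the final regret over the interval `e`, when the loss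
`L` has been accumulated on it so far and `-φ i` is the accumulated loss of the comparator `i`. -/
noncomputable def potential {I Z : Type*} (g : I → Z → ℝ) (ρ : ℝ) (e : Fin T × Fin T) (t : ℕ)
    (L : ℝ) (φ : I → ℝ) : ℝ :=
  L + rad g (remaining e t) φ + remaining e t * ρ

variable {I Z : Type*} [Nonempty I] [Nonempty Z] {g : I → Z → ℝ}

/-- The exponential of the potential of an interval grows by a factor governed by the excess of
the learner's loss over the loss of the mixture `K` recommended for this interval. -/
lemma exists_mixture_exp_potential_le (hg : ∀ i z, g i z ∈ Set.Icc (0 : ℝ) 1) (hT : 1 ≤ T)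
    {κ : ℝ} (hκ : 0 < κ) {η : ℝ} (hη : 0 < η) (hη1 : η ≤ 1) (e : Fin T × Fin T) (t : ℕ)
    (L : ℝ) {φ : I → ℝ} (hφ : BddAbove (Set.range φ)) :
    ∃ K ∈ mixtures I, ∀ (z : Z) (y : ℝ), y ∈ Set.Icc (0 : ℝ) 1 →
      Real.exp (η * potential g (rad g T (fun _ => 0) / T + κ) e (t + 1) (L + gate e t y)
          (fun i => φ i - gate e t (g i z))) ≤
        Real.exp (η * potential g (rad g T (fun _ => 0) / T + κ) e t L φ) *
          (1 + η ^ 2 + η * gate e t (y - K fun i => g i z)) := by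
  by_cases h : (e.1 : ℕ) ≤ t ∧ t ≤ e.2
  · have hr : remaining e t = remaining e (t + 1) + 1 := by
      unfold remaining; omega
    obtain ⟨K, hK, hK'⟩ := exists_mixture_rad_step hg hT (remaining e (t + 1)) hφ hκ
    refine ⟨K, hK, fun z y hy => ?_⟩
    have h1 := hK' z
    have h2 := mixture_mem_Icc hK (φ := fun i => g i z) fun i => hg i z
    simp only [gate, if_pos h]
    set u := y - K fun i => g i z with hu
    have hu1 : |u| ≤ 1 := by
      rw [abs_le]; constructor <;> linarith [hy.1, hy.2, h2.1, h2.2]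
    have h3 : potential g (rad g T (fun _ => 0) / T + κ) e (t + 1) (L + y)
        (fun i => φ i - g i z) ≤ potential g (rad g T (fun _ => 0) / T + κ) e t L φ + u := by
      unfold potential
      rw [hr]
      push_cast
      linarith
    have h4 : Real.exp (η * u) ≤ 1 + η ^ 2 + η * u := by
      have h5 : |η * u| ≤ 1 := by
        rw [abs_mul, abs_of_pos hη]
        exact mul_le_one₀ hη1 (abs_nonneg _) hu1
      have h6 := (abs_le.1 (Real.abs_exp_sub_one_sub_id_le h5)).2
      have h7 : (η * u) ^ 2 ≤ η ^ 2 := by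
        rw [mul_pow]
        exact mul_le_of_le_one_right (by positivity) ((sq_le_one_iff_abs_le_one u).2 hu1)
      linarith
    refine (Real.exp_le_exp.2 (mul_le_mul_of_nonneg_left h3 hη.le)).trans ?_
    rw [mul_add, Real.exp_add]
    exact mul_le_mul_of_nonneg_left h4 (Real.exp_nonneg _)
  · have hr : remaining e t = remaining e (t + 1) := by
      unfold remaining; omega
    obtain ⟨K, hK⟩ := mixtures_nonempty I
    refine ⟨K, hK, fun z y hy => ?_⟩
    simp only [gate, if_neg h, sub_zero, add_zero, mul_zero, potential, hr]
    exact le_mul_of_one_le_right (Real.exp_nonneg _) (by nlinarith)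

variable {F X : Type*} [Nonempty F] [Nonempty X] {loss : F → X → ℝ} {act : I → F → F}

/-- One round of the game: a mixture `Q` of predictions that is approximately stationary under the
combined recommendations of all intervals keeps the exponential potential under control,
whatever the opponent plays. -/
lemma exists_mixture_potential_round (hloss : ∀ f x, loss f x ∈ Set.Icc (0 : ℝ) 1) (hT : 1 ≤ T)
    {κ : ℝ} (hκ : 0 < κ) {η : ℝ} (hη : 0 < η) (hη1 : η ≤ 1) {η' : ℝ} (hη' : 0 < η') {ρ : ℝ}
    (hρ : ρ = rad (fun i (z : F × X) => loss (act i z.1) z.2) T (fun _ => 0) / T + κ) (t : ℕ)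
    (L : Fin T × Fin T → ℝ) {φ : Fin T × Fin T → I → ℝ} (hφ : ∀ e, BddAbove (Set.range (φ e))) :
    ∃ Q ∈ mixtures F, ∀ x : X,
      BddAbove (Set.range fun f => ∑ e, Real.exp (η *
        potential (fun i (z : F × X) => loss (act i z.1) z.2) ρ e (t + 1)
          (L e + gate e t (loss f x)) (fun i => φ e i - gate e t (loss (act i f) x)))) ∧
      Q (fun f => ∑ e, Real.exp (η *
        potential (fun i (z : F × X) => loss (act i z.1) z.2) ρ e (t + 1)
          (L e + gate e t (loss f x)) (fun i => φ e i - gate e t (loss (act i f) x)))) ≤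
        (1 + η ^ 2 + η * η') * ∑ e, Real.exp (η *
          potential (fun i (z : F × X) => loss (act i z.1) z.2) ρ e t (L e) (φ e)) := by
  subst hρ
  set g : I → F × X → ℝ := fun i z => loss (act i z.1) z.2 with hgdef
  have hg : ∀ i z, g i z ∈ Set.Icc (0 : ℝ) 1 := fun i z => hloss _ _
  have hstep := fun e => exists_mixture_exp_potential_le hg hT hκ hη hη1 e t (L e) (hφ e)
  choose K hK hK' using hstep
  set ρ := rad g T (fun _ => 0) / T + κ
  set W : Fin T × Fin T → ℝ := fun e => Real.exp (η * potential g ρ e t (L e) (φ e)) with hW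
  have hW0 : ∀ e, 0 ≤ W e := fun e => Real.exp_nonneg _
  have hgate : ∀ e, 0 ≤ gate e t (W e) ∧ gate e t (W e) ≤ W e := by
    intro e
    unfold gate
    split_ifs
    · exact ⟨hW0 e, le_rfl⟩
    · exact ⟨le_rfl, hW0 e⟩
  obtain ⟨Q, hQ, hQ'⟩ := exists_stationary_mixture_sum act hK (fun e => (hgate e).1) hη'
  refine ⟨Q, hQ, fun x => ?_⟩
  have hpt : ∀ f, ∑ e, Real.exp (η * potential g ρ e (t + 1) (L e + gate e t (loss f x))
      (fun i => φ e i - gate e t (loss (act i f) x))) ≤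
      (1 + η ^ 2) * ∑ e, W e + η * ∑ e, gate e t (W e) *
        (loss f x - K e fun i => loss (act i f) x) := by
    intro f
    rw [Finset.mul_sum, Finset.mul_sum, ← Finset.sum_add_distrib]
    refine Finset.sum_le_sum fun e _ => (hK' e (f, x) (loss f x) (hloss f x)).trans (le_of_eq ?_)
    change W e * _ = _
    simp only [gate, hgdef]
    split_ifs <;> ring
  constructor
  · refine ⟨(1 + η ^ 2) * ∑ e, W e + η * ∑ e, W e, ?_⟩
    rintro _ ⟨f, rfl⟩
    refine (hpt f).trans ?_
    gcongr with e
    have h1 := mixture_nonneg (hK e) (φ := fun i => loss (act i f) x) fun i => (hloss _ _).1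
    have h2 := (hloss f x).2
    calc gate e t (W e) * (loss f x - K e fun i => loss (act i f) x) ≤ gate e t (W e) * 1 :=
          mul_le_mul_of_nonneg_left (by linarith) (hgate e).1
      _ ≤ W e := by rw [mul_one]; exact (hgate e).2
  · refine (mixture_mono hQ hpt).trans ?_
    have e1 : (fun f => (1 + η ^ 2) * ∑ e, W e + η * ∑ e, gate e t (W e) *
        (loss f x - K e fun i => loss (act i f) x)) =
        (fun _ => (1 + η ^ 2) * ∑ e, W e) + η • ∑ e, gate e t (W e) •
          ((fun f => loss f x) - fun f => K e fun i => loss (act i f) x) := by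
      ext f
      simp [Finset.sum_apply]
    rw [e1, map_add, mixture_const hQ, map_smul, map_sum]
    simp only [map_smul, map_sub, smul_eq_mul]
    have h3 := hQ' (fun f => loss f x) fun f => hloss f x
    have h4 : ∑ e, gate e t (W e) ≤ ∑ e, W e := Finset.sum_le_sum fun e _ => (hgate e).2
    have h5 := mul_le_mul_of_nonneg_left (h3.trans (mul_le_mul_of_nonneg_left h4 hη'.le)) hη.le
    linarith

/-- The value of the game whose payoff is an affine function of the exponential potential. -/
lemma gameValue_exp_potential_le [MeasurableSpace F] [MeasurableSingletonClass F]
    (hloss : ∀ f x, loss f x ∈ Set.Icc (0 : ℝ) 1) (hT : 1 ≤ T)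
    {κ : ℝ} (hκ : 0 < κ) {η : ℝ} (hη : 0 < η) (hη1 : η ≤ 1) {η' : ℝ} (hη' : 0 < η') {ρ : ℝ}
    (hρ : ρ = rad (fun i (z : F × X) => loss (act i z.1) z.2) T (fun _ => 0) / T + κ)
    (A : ℝ) {c : ℝ} (hc : 0 ≤ c) (n t : ℕ) (hnt : t + n = T)
    (L : Fin T × Fin T → ℝ) {φ : Fin T × Fin T → I → ℝ} (hφ : ∀ e, BddAbove (Set.range (φ e))) :
    gameValue n (fun (f : Fin n → F) (x : Fin n → X) => ((A + c * ∑ e, Real.exp (η *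
        (L e + ∑ j : Fin n, gate e (t + j) (loss (f j) (x j)) +
          ⨆ i, (φ e i - ∑ j : Fin n, gate e (t + j) (loss (act i (f j)) (x j))))) : ℝ) : EReal)) ≤
      ((A + c * ((1 + η ^ 2 + η * η') ^ n * ∑ e, Real.exp (η *
        potential (fun i (z : F × X) => loss (act i z.1) z.2) ρ e t (L e) (φ e))) : ℝ) :
          EReal) := by
  induction n generalizing t L φ with
  | zero =>
    rw [gameValue, EReal.coe_le_coe_iff]
    have h0 : ∀ e : Fin T × Fin T, remaining e t = 0 := by
      intro e
      have := e.2.isLt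
      unfold remaining; omega
    simp [potential, h0, rad]
  | succ n ih =>
    obtain ⟨Q, hQ, hQ'⟩ := exists_mixture_potential_round hloss hT hκ hη hη1 hη' hρ t L hφ
    obtain ⟨q, hq⟩ := exists_probabilityMeasure_expectation_le hQ
    rw [gameValue]
    refine iInf_le_of_le q (iSup_le fun x => ?_)
    obtain ⟨⟨C, hC⟩, hx⟩ := hQ' x
    set γ := 1 + η ^ 2 + η * η' with hγ
    have hγ0 : 0 ≤ γ := by positivity
    have hb : ∀ f e, BddAbove (Set.range fun i => φ e i - gate e t (loss (act i f) x)) := by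
      intro f e
      simp only [sub_eq_add_neg]
      refine bddAbove_add (γ := fun i => -gate e t (loss (act i f) x)) (c := 0) (hφ e) fun i => ?_
      unfold gate
      split_ifs
      · linarith [(hloss (act i f) x).1]
      · simp
    have hcγ : 0 ≤ c * γ ^ n := by positivity
    refine (hq _ (fun f => A + c * (γ ^ n * ∑ e, Real.exp (η *
      potential (fun i (z : F × X) => loss (act i z.1) z.2) ρ e (t + 1)
        (L e + gate e t (loss f x)) (fun i => φ e i - gate e t (loss (act i f) x))))) ?_ ?_).trans
      ?_
    · refine ⟨A + c * γ ^ n * C, ?_⟩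
      rintro _ ⟨f, rfl⟩
      have := mul_le_mul_of_nonneg_left (hC ⟨f, rfl⟩) hcγ
      dsimp only at this ⊢
      rw [← mul_assoc]
      linarith
    · intro f
      refine le_trans (le_of_eq ?_) (ih (t + 1) (by omega) (fun e => L e + gate e t (loss f x))
        (hb f))
      congr 1
      funext fs xs
      simp only [Fin.sum_univ_succ, Fin.cons_zero, Fin.cons_succ, Fin.val_zero, Fin.val_succ,
        add_zero]
      have hidx : ∀ j : Fin n, t + ((j : ℕ) + 1) = t + 1 + j := fun j => by omega
      have hassoc : ∀ a b c : ℝ, a + (b + c) = a + b + c := fun a b c => (add_assoc a b c).symm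
      simp only [hidx, sub_sub, hassoc]
    · rw [EReal.coe_le_coe_iff]
      have e1 : (fun f => A + c * (γ ^ n * ∑ e, Real.exp (η *
          potential (fun i (z : F × X) => loss (act i z.1) z.2) ρ e (t + 1)
            (L e + gate e t (loss f x)) (fun i => φ e i - gate e t (loss (act i f) x))))) =
          (fun _ => A) + (c * γ ^ n) • fun f => ∑ e, Real.exp (η *
          potential (fun i (z : F × X) => loss (act i z.1) z.2) ρ e (t + 1)
            (L e + gate e t (loss f x)) (fun i => φ e i - gate e t (loss (act i f) x))) := by
        ext f
        simp [mul_assoc]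
      rw [e1, map_add, map_smul, mixture_const hQ, smul_eq_mul]
      have := mul_le_mul_of_nonneg_left hx hcγ
      rw [pow_succ]
      linarith

end Game

/-! ### Adaptive regret -/

/-- The adaptive regret is at most an affine function of the sum over all intervals of the
exponentials of their terminal potentials. With a parameter `a`, this is the tangent line bound
`η y ≤ exp (η y - a) - 1 + a`, whose right side, unlike a logarithm, commutes with
expectations. -/
lemma adaptiveRegret_le {F X : Type*} {loss : F → X → ℝ} {Ψ : Set (F → F)} {T : ℕ}
    (hloss : ∀ f x, loss f x ∈ Set.Icc (0 : ℝ) 1) (hT : 1 ≤ T) {η a : ℝ} (hη : 0 < η)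
    (f : Fin T → F) (x : Fin T → X) :
    adaptiveRegret loss Ψ f x ≤ (((1 / (T * η)) * (a - 1) + (1 / (T * η) * Real.exp (-a)) *
      ∑ e : Fin T × Fin T, Real.exp (η * (0 + ∑ j : Fin T, gate e (0 + j) (loss (f j) (x j)) +
        ⨆ i : Ψ, (0 - ∑ j : Fin T, gate e (0 + j) (loss (i.1 (f j)) (x j))))) : ℝ) : EReal) := by
  have hT' : (0 : ℝ) < T := by exact_mod_cast hT
  refine iSup_le fun r => iSup_le fun s => iSup_le fun _ => ?_
  have hgate : ∀ y : Fin T → ℝ, ∑ j : Fin T, gate (r, s) (0 + j) (y j) =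
      ∑ j ∈ Finset.Icc r s, y j := by
    intro y
    simp only [gate, zero_add, Fin.val_fin_le, ← Finset.sum_filter]
    congr 1
    ext j
    simp
  set R : ℝ := (1 / (T * η)) * (a - 1) + (1 / (T * η) * Real.exp (-a)) *
      ∑ e : Fin T × Fin T, Real.exp (η * (0 + ∑ j : Fin T, gate e (0 + j) (loss (f j) (x j)) +
        ⨆ i : Ψ, (0 - ∑ j : Fin T, gate e (0 + j) (loss (i.1 (f j)) (x j))))) with hR
  set S := 1 / (T : ℝ) * ∑ t ∈ Finset.Icc r s, loss (f t) (x t) with hS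
  have hreal : ∀ ψ ∈ Ψ, S - R ≤ 1 / (T : ℝ) * ∑ t ∈ Finset.Icc r s, loss (ψ (f t)) (x t) := by
    intro ψ hψ
    set y := ∑ t ∈ Finset.Icc r s, loss (f t) (x t) - ∑ t ∈ Finset.Icc r s, loss (ψ (f t)) (x t)
      with hy
    have hbdd : BddAbove (Set.range fun i : Ψ =>
        (0 - ∑ j : Fin T, gate (r, s) (0 + j) (loss (i.1 (f j)) (x j)))) := by
      refine ⟨0, ?_⟩
      rintro _ ⟨i, rfl⟩
      dsimp only
      rw [hgate fun j => loss (i.1 (f j)) (x j)]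
      linarith [Finset.sum_nonneg fun j (_ : j ∈ Finset.Icc r s) => (hloss (i.1 (f j)) (x j)).1]
    have h1 := le_ciSup hbdd ⟨ψ, hψ⟩
    dsimp only at h1
    rw [hgate fun j => loss (ψ (f j)) (x j)] at h1
    have h2 : Real.exp (η * y) ≤ ∑ e : Fin T × Fin T, Real.exp (η * (0 +
        ∑ j : Fin T, gate e (0 + j) (loss (f j) (x j)) +
        ⨆ i : Ψ, (0 - ∑ j : Fin T, gate e (0 + j) (loss (i.1 (f j)) (x j))))) := by
      refine le_trans (Real.exp_le_exp.2 (mul_le_mul_of_nonneg_left ?_ hη.le))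
        (Finset.single_le_sum (f := fun e : Fin T × Fin T => Real.exp (η * (0 +
        ∑ j : Fin T, gate e (0 + j) (loss (f j) (x j)) +
        ⨆ i : Ψ, (0 - ∑ j : Fin T, gate e (0 + j) (loss (i.1 (f j)) (x j))))))
        (fun e _ => Real.exp_nonneg _) (Finset.mem_univ (r, s)))
      rw [hgate fun j => loss (f j) (x j)]
      linarith
    have h3 := mul_le_mul_of_nonneg_left h2 (Real.exp_nonneg (-a))
    rw [← Real.exp_add] at h3
    have h4 := Real.add_one_le_exp (-a + η * y)
    have h5 : 1 / (T : ℝ) * y ≤ R := by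
      have e1 : 1 / (T : ℝ) * y = (1 / (T * η)) * (η * y) := by field_simp
      rw [e1, hR, mul_assoc (1 / (T * η) : ℝ), ← mul_add]
      exact mul_le_mul_of_nonneg_left (by linarith) (by positivity)
    rw [hy, mul_sub] at h5
    linarith
  have hinf : ((S - R : ℝ) : EReal) ≤ ⨅ ψ ∈ Ψ,
      ((1 / (T : ℝ) * ∑ t ∈ Finset.Icc r s, loss (ψ (f t)) (x t) : ℝ) : EReal) :=
    le_iInf₂ fun ψ hψ => EReal.coe_le_coe_iff.2 (hreal ψ hψ)
  refine (EReal.sub_le_sub le_rfl hinf).trans (le_of_eq ?_)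
  rw [← EReal.coe_sub]
  congr 1
  ring

/-- The bound for the value of the game, with all parameters of the learner's strategy free. -/
lemma gameValue_adaptiveRegret_le {F X : Type*} [MeasurableSpace F] [MeasurableSingletonClass F]
    [Nonempty F] [Nonempty X] {loss : F → X → ℝ} {Ψ : Set (F → F)} {T : ℕ}
    (hloss : ∀ f x, loss f x ∈ Set.Icc (0 : ℝ) 1) (hΨ : Ψ.Nonempty) (hT : 1 ≤ T)
    {κ : ℝ} (hκ : 0 < κ) {η : ℝ} (hη : 0 < η) (hη1 : η ≤ 1) :
    gameValue T (fun (f : Fin T → F) (x : Fin T → X) => adaptiveRegret loss Ψ f x) ≤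
      ((2 * (rad (fun (i : Ψ) (z : F × X) => loss (i.1 z.1) z.2) T (fun _ => 0) / T) +
        2 * (Real.log T / T / η) + η + 2 * κ : ℝ) : EReal) := by
  have : Nonempty Ψ := hΨ.to_subtype
  have hT' : (0 : ℝ) < T := by exact_mod_cast hT
  set g : Ψ → F × X → ℝ := fun i z => loss (i.1 z.1) z.2 with hgdef
  have hg : ∀ i z, g i z ∈ Set.Icc (0 : ℝ) 1 := fun i z => hloss _ _
  set D := rad g T (fun _ => 0) with hD
  have hD0 : 0 ≤ D := rad_zero_nonneg hg T
  set ρ := D / T + κ with hρ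
  have hρ0 : 0 ≤ ρ := by positivity
  set γ := 1 + η ^ 2 + η * κ with hγ
  have hγ0 : 0 < γ := by positivity
  -- The logarithm of an upper bound for the expected terminal potential.
  set a := 2 * Real.log T + T * Real.log γ + η * (D + T * ρ) with ha
  have h1 := gameValue_mono T (fun f x => adaptiveRegret_le (Ψ := Ψ) (a := a) hloss hT hη f x)
  have h2 := gameValue_exp_potential_le (act := fun (i : Ψ) f => i.1 f) hloss hT hκ hη hη1 hκ hρ
    ((1 / (T * η)) * (a - 1)) (c := 1 / (T * η) * Real.exp (-a)) (by positivity) T 0 (by simp)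
    (fun _ => 0) (φ := fun _ _ => 0) (fun _ => bddAbove_range_const 0)
  refine h1.trans (h2.trans (EReal.coe_le_coe_iff.2 ?_))
  have hpot : ∀ e : Fin T × Fin T, potential g ρ e 0 0 (fun _ => 0) ≤ D + T * ρ := by
    intro e
    have hr : remaining e 0 ≤ T := by
      have := e.2.isLt
      unfold remaining; omega
    have h3 := rad_zero_mono hg hr
    have h4 : (remaining e 0 : ℝ) * ρ ≤ T * ρ :=
      mul_le_mul_of_nonneg_right (by exact_mod_cast hr) hρ0
    unfold potential
    linarith
  have hsum : γ ^ T * ∑ e : Fin T × Fin T, Real.exp (η * potential g ρ e 0 0 (fun _ => 0)) ≤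
      Real.exp a := by
    have h5 : ∑ e : Fin T × Fin T, Real.exp (η * potential g ρ e 0 0 (fun _ => 0)) ≤
        (T : ℝ) ^ 2 * Real.exp (η * (D + T * ρ)) := by
      refine (Finset.sum_le_card_nsmul _ _ (Real.exp (η * (D + T * ρ))) fun e _ =>
        Real.exp_le_exp.2 (mul_le_mul_of_nonneg_left (hpot e) hη.le)).trans (le_of_eq ?_)
      simp [pow_two]
    refine (mul_le_mul_of_nonneg_left h5 (by positivity)).trans (le_of_eq ?_)
    have e1 : Real.exp (2 * Real.log T) = (T : ℝ) ^ 2 := by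
      rw [mul_comm, Real.exp_mul, Real.exp_log hT']
      norm_cast
    have e2 : Real.exp (T * Real.log γ) = γ ^ T := by
      rw [mul_comm, Real.exp_mul, Real.exp_log hγ0, Real.rpow_natCast]
    rw [ha, Real.exp_add, Real.exp_add, e1, e2]
    ring
  have h6 := mul_le_mul_of_nonneg_left hsum (Real.exp_nonneg (-a))
  rw [← Real.exp_add, neg_add_cancel, Real.exp_zero] at h6
  have h7 : (1 / (T * η)) * (a - 1) + 1 / (T * η) * Real.exp (-a) * (γ ^ T *
      ∑ e : Fin T × Fin T, Real.exp (η * potential g ρ e 0 0 (fun _ => 0))) ≤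
      1 / (T * η) * a := by
    rw [mul_assoc (1 / (T * η) : ℝ), ← mul_add]
    exact mul_le_mul_of_nonneg_left (by linarith) (by positivity)
  refine h7.trans ?_
  have h8 : Real.log γ ≤ η ^ 2 + η * κ := by
    have := Real.log_le_sub_one_of_pos hγ0
    rw [hγ] at this ⊢
    linarith
  have h9 : a ≤ 2 * Real.log T + T * (η ^ 2 + η * κ) + η * (D + T * ρ) := by
    rw [ha]; gcongr
  refine (mul_le_mul_of_nonneg_left h9 (by positivity)).trans (le_of_eq ?_)
  rw [hρ]
  field_simp
  ring

end AdaptiveRegret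

theorem mainTheorem7 {F X : Type*}
    [MetricSpace F] [TopologicalSpace.SeparableSpace F] [MeasurableSpace F] [BorelSpace F]
    [CompactSpace (ProbabilityMeasure F)] [Nonempty F]
    [MetricSpace X] [TopologicalSpace.SeparableSpace X] [MeasurableSpace X] [BorelSpace X]
    [CompactSpace (ProbabilityMeasure X)] [Nonempty X]
    (loss : F → X → ℝ) (hloss : ∀ f x, loss f x ∈ Set.Icc (0 : ℝ) 1)
    (Ψ : Set (F → F)) (hΨ : Ψ.Nonempty) (T : ℕ) (hT : 1 ≤ T) :
    AdaptiveRegret.gameValue T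
        (fun (f : Fin T → F) (x : Fin T → X) => AdaptiveRegret.adaptiveRegret loss Ψ f x) ≤
      ((8 * AdaptiveRegret.entropyIntegral loss Ψ T +
        ENNReal.ofReal (96 * Real.sqrt (Real.log T / T)) : ℝ≥0∞) : EReal) := by
  have hT' : (0 : ℝ) < T := by exact_mod_cast hT
  set s := Real.sqrt (Real.log T / T) with hs
  have hlog : 0 ≤ Real.log T / T :=
    div_nonneg (Real.log_nonneg (by exact_mod_cast hT)) hT'.le
  have hs0 : 0 ≤ s := Real.sqrt_nonneg _
  have hs1 : s < 1 := by
    rw [hs, Real.sqrt_lt' one_pos, one_pow, div_lt_one hT']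
    linarith [Real.log_le_sub_one_of_pos hT']
  set D := AdaptiveRegret.rad (fun (i : Ψ) (z : F × X) => loss (i.1 z.1) z.2) T (fun _ => 0)
    with hD
  have hval : AdaptiveRegret.gameValue T
      (fun (f : Fin T → F) (x : Fin T → X) => AdaptiveRegret.adaptiveRegret loss Ψ f x) ≤
      ((2 * (D / T) + 3 * s : ℝ) : EReal) := by
    refine EReal.le_of_forall_lt_iff_le.1 fun r hr => ?_
    rw [EReal.coe_lt_coe_iff] at hr
    -- For `T = 1` the optimal learning rate `s` vanishes, so it is shifted slightly.
    set κ := min ((r - (2 * (D / T) + 3 * s)) / 3) (1 - s) with hκ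
    have hκ0 : 0 < κ := lt_min (by linarith) (by linarith)
    have hκ1 : κ ≤ (r - (2 * (D / T) + 3 * s)) / 3 := min_le_left _ _
    have hκ2 : κ ≤ 1 - s := min_le_right _ _
    refine (AdaptiveRegret.gameValue_adaptiveRegret_le hloss hΨ hT hκ0 (η := s + κ)
      (by linarith) (by linarith)).trans (EReal.coe_le_coe_iff.2 ?_)
    have h1 : Real.log T / T / (s + κ) ≤ s := by
      rw [div_le_iff₀ (by linarith), ← Real.mul_self_sqrt hlog, ← hs, mul_add]
      linarith [mul_nonneg hs0 hκ0.le]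
    linarith
  refine hval.trans ?_
  have h2 := AdaptiveRegret.rad_le_entropyIntegral loss Ψ T hloss hΨ hT
  rw [← hD] at h2
  have h3 : ENNReal.ofReal (2 * (D / T) + 3 * s) ≤
      8 * AdaptiveRegret.entropyIntegral loss Ψ T + ENNReal.ofReal (96 * s) := by
    refine ENNReal.ofReal_add_le.trans (add_le_add ?_ (ENNReal.ofReal_le_ofReal (by linarith)))
    have e : 2 * (D / T) = 8 * (D / (4 * T)) := by ring
    rw [e, ENNReal.ofReal_mul (by norm_num), ENNReal.ofReal_ofNat]
    gcongr
  refine le_trans ?_ (EReal.coe_ennreal_le_coe_ennreal_iff.2 h3)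
  rw [EReal.coe_ennreal_ofReal]
  exact EReal.coe_le_coe_iff.2 (le_max_left _ _)
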